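/- **Setting.** Let $\Theta=\{-1,0,1\}^{\mathbb Z}$ with its product $\sigma$-algebra. Ballistic annihilation (BA) is the map $A:\Theta\to\Theta$ with $(A\zeta)(x)=1$ if $\zeta(x-1)=1$ and neither $\zeta(x)=-1$ nor both $\zeta(x)=0,\ \zeta(x+1)=-1$; $(A\zeta)(x)=-1$ if $\zeta(x+1)=-1$ and neither $\zeta(x)=1$ nor both $\zeta(x)=0,\ \zeta(x-1)=1$; and $(A\zeta)(x)=0$ otherwise. A site $x$ with $\zeta(x)=1$ (resp. $-1$) holds a positive (resp. negative) particle. A converging pair in $\zeta$ is a positive particle at $i$ and a negative particle at $j>i$ with no particle strictly between them. Let $\Theta_s$ be the set of $\zeta\in\Theta$ that have exactly one converging pair, infinitely many positive and infinitely many negative particles. Let $\mathcal S$ be the set of probability measures $\mu$ on $\Theta$ that are concentrated on $\Theta_s$, and $\mathcal I$ the set of those with $\mu\circ A^{-1}=\mu$. Let $\mathbb H=\mathbb Z\cup(\mathbb Z+\frac12)$ and $$E=\{e:\mathbb H\to\mathbb H \;:\; e_i\in\mathbb Z\ \ \forall i\in\mathbb Z,\quad e_i-e_{i+\frac12}\in\{-\tfrac12,\tfrac12\}\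 \ \forall i\in\mathbb H\},\qquad (\tau_E e)_i=e_{i+1},$$ and let $\mathcal E_\tau$ be the set of $\tau_E$-invariant probability measures on $E$. Let $$\Omega=\{\omega=(\omega_n)_{n\in\mathbb Z}\in\Theta^{\mathbb Z} \;:\; \omega_n\in\Theta_s,\ \omega_{n+1}=A\omega_n\ \ \forall n\in\mathbb Z\},\qquad (\tau_\Omega\omega)_n=\omega_{n-1}.$$ Both $E$ and $\Omega$ carry the $\sigma$-algebra generated by the cylinders. For $\mu\in\mathcal S\cap\mathcal I$, a two-sided BA with marginal $\mu$ is a $\tau_\Omega$-invariant probability measure on $\Omega$ under which every $\omega_n$ has law $\mu$. For $\omega\in\Omega$ define $\omega'\in\{-1,0,1\}^{\mathbb H\times\mathbb H}$ as follows, for $n\in\mathbb Z$: $\omega'_n(m)=\omega_n(m)$ for $m\in\mathbb Z$ and $\omega'_n(m)=0$ for $m\in\mathbb Z+\frac12$; $\omega'_{n+1/2}(m)=0$ for $m\in\mathbb Z$; and for $m\in\mathbb Z+\frac12$, $\omega'_{n+1/2}(m)=1$ if $\omega_n(m-\frac12)=1$ and $\omega_n(m+\frac12)\ne-1$, $\omega'_{n+1/2}(m)=-1$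 if $\omega_n(m+\frac12)=-1$ and $\omega_n(m-\frac12)\neq1$, and $\omega'_{n+1/2}(m)=0$ otherwise. A path $e\in E$ is a *second-class path* of $\omega$ if for all $n,m\in\mathbb H$: 1. if $\omega'_n(m)=0$, $\omega'_{n-1/2}(m-\frac12)=1$ and $\omega'_{n-1/2}(m+\frac12)=-1$, then $e_n=m$; 2. if $e_{n-1/2}=m$ and $\omega'_{n-1/2}(m)=-1$, then $e_n=e_{n-1/2}-\frac12$; 3. if $e_{n-1/2}=m$ and $\omega'_{n-1/2}(m)=0$, then $e_n=e_{n-1/2}+\frac12$. **Theorem 2.3.** For every $\mu\in\mathcal S\cap\mathcal I$ there is exactly one two-sided BA with marginal $\mu$; denote it by $\mathbb P^\mu_\Omega$. There is a measurable map $F:\Omega\to E$ such that for every $\mu\in\mathcal S\cap\mathcal I$ and $\mathbb P^\mu_\Omega$-almost every $\omega$: $F(\omega)$ is the unique second-class path of $\omega$, and $\omega$ is the only element of $\Omega$ that has $F(\omega)$ as a second-class path. Moreover $$F^\ast(\mu):=\mathbb P^\mu_\Omega\circ F^{-1}$$ defines a bijection $F^\ast:\mathcal S\cap\mathcal I\to\mathcal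 E_\tau$. -/

import Mathlib

open MeasureTheory

namespace BallisticAnnihilation

/-- The three values `-1, 0, 1` carry the discrete sigma-algebra. -/
instance instMeasurableSpaceSignType : MeasurableSpace SignType := ⊤

/-- The configuration space `{-1, 0, 1}^ℤ`, with the product (cylinder) sigma-algebra.
`ζ x = 1`, `ζ x = -1`, `ζ x = 0`: at `x` there is a particle of velocity `1`, a particle of
velocity `-1`, no particle. -/
abbrev Config : Type := ℤ → SignType

open Classical in
/-- One unit of time of ballistic annihilation. -/
noncomputable def step (ζ : Config) : Config := fun x =>
  if ζ (x - 1) = 1 ∧ ¬ (ζ x = -1) ∧ ¬ (ζ x = 0 ∧ ζ (x + 1) = -1) then 1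
  else if ζ (x + 1) = -1 ∧ ¬ (ζ x = 1) ∧ ¬ (ζ x = 0 ∧ ζ (x - 1) = 1) then -1
  else 0

/-- The pair of sites `p = (i, j)` holds a pair of subsequent converging particles:
a positive particle at `i`, a negative one at `j > i`, and no particle in between. -/
def IsConvergingPair (ζ : Config) (p : ℤ × ℤ) : Prop :=
  p.1 < p.2 ∧ ζ p.1 = 1 ∧ ζ p.2 = -1 ∧ ∀ k, p.1 < k → k < p.2 → ζ k = 0

/-- The phase separation configurations: there is exactly one pair of subsequent converging
particles, and there are infinitely many positive and infinitely many negative particles. -/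
def phaseSepConfigs : Set Config :=
  {ζ | (∃! p : ℤ × ℤ, IsConvergingPair ζ p) ∧ {i | ζ i = 1}.Infinite ∧ {i | ζ i = -1}.Infinite}

/-- Phase separation measures: probability measures concentrated on `phaseSepConfigs`. -/
def phaseSepMeasures : Set (ProbabilityMeasure Config) :=
  {μ | ∀ᵐ ζ ∂(μ : Measure Config), ζ ∈ phaseSepConfigs}

/-- Probability measures that are invariant for ballistic annihilation. -/
def invariantMeasures : Set (ProbabilityMeasure Config) :=
  {μ | MeasurePreserving step (μ : Measure Config) (μ : Measure Config)}

/-- Trajectories of ballistic annihilation with doubly infinite time, made of phase separation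
configurations; `ω n m` is the value at time `n` and site `m`. It carries the sigma-algebra
generated by the cylinders. -/
def Trajectory : Type :=
  {ω : ℤ → Config // ∀ n, ω n ∈ phaseSepConfigs ∧ ω (n + 1) = step (ω n)}

instance : MeasurableSpace Trajectory := inferInstanceAs (MeasurableSpace (Subtype _))

instance : CoeFun Trajectory (fun _ => ℤ → Config) := ⟨Subtype.val⟩

/-- The shift of time on trajectories, `ω_n ↦ ω_{n-1}`. -/
def Trajectory.shift (ω : Trajectory) : Trajectory :=
  ⟨fun n => ω (n - 1), fun n => ⟨(ω.2 (n - 1)).1, by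
    have h := (ω.2 (n - 1)).2
    rwa [show n - 1 + 1 = n + 1 - 1 by ring] at h⟩⟩

/-- `P` is ballistic annihilation with doubly infinite time and marginal distributions `μ`:
a law on trajectories that is stationary in time and has marginal `μ` at each time. -/
structure IsTwoSidedBA (μ : ProbabilityMeasure Config) (P : ProbabilityMeasure Trajectory) :
    Prop where
  marginal : ∀ n : ℤ, (P : Measure Trajectory).map (fun ω => ω n) = (μ : Measure Config)
  stationary : MeasurePreserving Trajectory.shift
    (P : Measure Trajectory) (P : Measure Trajectory)

/-- The set `ℤ ∪ (ℤ + 1/2)`, that is, the additive group of all integer multiples of `1/2`. -/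
abbrev HalfInt : Type := AddSubgroup.zmultiples ((1 : ℚ) / 2)

/-- The element `1/2` of `ℤ ∪ (ℤ + 1/2)`. -/
def half : HalfInt := ⟨1 / 2, AddSubgroup.mem_zmultiples _⟩

/-- The half-integer `x` is an integer. -/
def IsInt (x : HalfInt) : Prop := ∃ k : ℤ, (x : ℚ) = k

open Classical in
/-- The record `ω'` of the trajectory `ω` at all times and places in `ℤ ∪ (ℤ + 1/2)`:
it agrees with `ω` at integer times, while at time `n + 1/2` the surviving particles of time `n`
have moved by half a unit to places in `ℤ + 1/2`, and those that were neighbours of opposite,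
converging velocities have annihilated. For `x ∈ ℤ + 1/2` one has `⌊x⌋ = x - 1/2`. -/
noncomputable def halfRecord (ω : Trajectory) (n m : HalfInt) : SignType :=
  if IsInt n then
    if IsInt m then ω ⌊(n : ℚ)⌋ ⌊(m : ℚ)⌋ else 0
  else if IsInt m then 0
  else if ω ⌊(n : ℚ)⌋ ⌊(m : ℚ)⌋ = 1 ∧ ω ⌊(n : ℚ)⌋ (⌊(m : ℚ)⌋ + 1) ≠ -1 then 1
  else if ω ⌊(n : ℚ)⌋ (⌊(m : ℚ)⌋ + 1) = -1 ∧ ω ⌊(n : ℚ)⌋ ⌊(m : ℚ)⌋ ≠ 1 then -1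
  else 0

/-- Two particles annihilate at time `n` at the place `m`. -/
def IsAnnihilation (ω : Trajectory) (n m : HalfInt) : Prop :=
  halfRecord ω n m = 0 ∧ halfRecord ω (n - half) (m - half) = 1 ∧ halfRecord ω (n - half) (m + half) = -1

/-- The path space `E`: paths indexed by `ℤ ∪ (ℤ + 1/2)` with increments `± 1/2` that are at
integer places at integer times. It carries the sigma-algebra generated by the cylinders. -/
def PathSpace : Type :=
  {e : HalfInt → HalfInt // (∀ i, IsInt i → IsInt (e i)) ∧
    ∀ i, e i - e (i + half) = -half ∨ e i - e (i + half) = half}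

instance : MeasurableSpace PathSpace := inferInstanceAs (MeasurableSpace (Subtype _))

instance : CoeFun PathSpace (fun _ => HalfInt → HalfInt) := ⟨Subtype.val⟩

/-- The sum of two halves is an integer, so adding it preserves integrality. -/
theorem IsInt.add_half_half {i : HalfInt} (h : IsInt i) : IsInt (i + (half + half)) := by
  obtain ⟨k, hk⟩ := h
  refine ⟨k + 1, ?_⟩
  simp only [AddSubgroup.coe_add, half, hk]
  push_cast
  ring

/-- The shift of time by `1` on paths, `e_i ↦ e_{i+1}`; here `1` is written `half + half`. -/
def PathSpace.shift (e : PathSpace) : PathSpace :=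
  ⟨fun i => e (i + (half + half)), fun i hi => e.2.1 _ hi.add_half_half, fun i => by
    have h := e.2.2 (i + (half + half))
    rwa [show i + (half + half) + half = i + half + (half + half) by abel] at h⟩

/-- Probability measures on the path space that are invariant under the time shift by `1`. -/
def invariantPathMeasures : Set (ProbabilityMeasure PathSpace) :=
  {Q | MeasurePreserving PathSpace.shift (Q : Measure PathSpace) (Q : Measure PathSpace)}

/-- `e` is a path of the second class particle in the trajectory `ω`:
it is at every annihilation place at the time of the annihilation; when it sits on a negative
particle it moves along with it; when it sits at an empty place it moves to the right. -/
structure IsSecondClassPath (ω : Trajectory) (e : PathSpace) : Prop where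
  annihilation : ∀ n m, IsAnnihilation ω n m → e n = m
  negative : ∀ n, halfRecord ω (n - half) (e (n - half)) = -1 → e n = e (n - half) - half
  empty : ∀ n, halfRecord ω (n - half) (e (n - half)) = 0 → e n = e (n - half) + half

end BallisticAnnihilation

open BallisticAnnihilation

open MeasureTheory

namespace BallisticAnnihilation

/-! Count time in half units `k` and replace a place `x` by `u = x - k/2`. In this moving frame
positive particles rest, negative ones jump one site to the left, and a path either stays (a step to
the right) or moves by `-1` (a step to the left). Uniqueness of the converging pair at all integer
times forces all positive particles to lie to the left of all negative ones
(`IsEvolution.isSeparated`). Then every particle is annihilated at some later time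
(`IsSeparated.pos_iff_exists_collide`), so the annihilations determine the whole evolution
(`IsSeparated.ext_collide`).

The core is deterministic. If a second-class path steps infinitely often both ways, in the past and
in the future, then annihilations happen exactly at its turns from left to right
(`IsSecondClass.collide_iff`), so the path determines the evolution. Conversely, `evolutionOf`
builds a separated evolution from the turns of such a path. On the other side, if annihilations
occur arbitrarily far in the past, the rules leave a path no choice after any of them
(`IsSecondClass.eq_of_collide`), and an explicit formula gives one that oscillates
(`IsSeparated.exists_isSecondClass`). This yields mutually inverse maps between oscillating paths
and trajectories that annihilate in the past; they intertwine the time shifts and, by Lusin–Souslin,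
have measurable extensions.

Poincaré recurrence shows that both classes have full measure under invariant laws (`ae_oscillates`,
`ae_annihilatesInPast`). Existence of the two-sided process is the natural extension of a measure
preserving map (`exists_backward_orbit_measure`); uniqueness holds because the configuration at one
time fixes the whole future (`Trajectory.measure_ext`). -/

theorem sign_eq_zero {s : SignType} (h₁ : s ≠ 1) (h₂ : s ≠ -1) : s = 0 := by
  revert s; decide

theorem sign_neg_eq_one {s : SignType} : -s = 1 ↔ s = -1 := by
  revert s; decide

theorem sign_neg_eq_neg_one {s : SignType} : -s = -1 ↔ s = 1 := by
  revert s; decide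

/-! ### The dynamics in the moving frame, and its mirror symmetry. -/

/-- Ballistic annihilation observed every half unit of time, in the frame moving with the positive
particles: those rest, while the negative ones jump by one to the left. -/
structure IsEvolution (W : ℤ → ℤ → SignType) : Prop where
  pos_iff : ∀ k u, W (k + 1) u = 1 ↔ W k u = 1 ∧ W k (u + 1) ≠ -1
  neg_iff : ∀ k u, W (k + 1) u = -1 ↔ W k (u + 1) = -1 ∧ W k u ≠ 1

/-- The particles at `u` and `u + 1` annihilate at `u` between the times `k` and `k + 1`. -/
def Collide (W : ℤ → ℤ → SignType) (k u : ℤ) : Prop := W k u = 1 ∧ W k (u + 1) = -1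

/-- The mirror image, which exchanges positive and negative particles. -/
def mirror (W : ℤ → ℤ → SignType) (k u : ℤ) : SignType := -W k (-u - k)

theorem mirror_eq_one {W : ℤ → ℤ → SignType} {k u : ℤ} :
    mirror W k u = 1 ↔ W k (-u - k) = -1 := sign_neg_eq_one

theorem mirror_eq_neg_one {W : ℤ → ℤ → SignType} {k u : ℤ} :
    mirror W k u = -1 ↔ W k (-u - k) = 1 := sign_neg_eq_neg_one

theorem collide_mirror {W : ℤ → ℤ → SignType} {k u : ℤ} :
    Collide (mirror W) k u ↔ Collide W k (-u - 1 - k) := by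
  rw [Collide, Collide, mirror_eq_one, mirror_eq_neg_one, and_comm,
    show -(u + 1) - k = -u - 1 - k by ring, show -u - 1 - k + 1 = -u - k by ring]

namespace IsEvolution

variable {W : ℤ → ℤ → SignType}

theorem mirror (h : IsEvolution W) : IsEvolution (mirror W) where
  pos_iff k u := by
    rw [Ne, mirror_eq_one, mirror_eq_one, mirror_eq_neg_one,
      show -u - (k + 1) = -u - k - 1 by ring, h.neg_iff,
      show -u - k - 1 + 1 = -u - k by ring, show -(u + 1) - k = -u - k - 1 by ring]
  neg_iff k u := by
    rw [Ne, mirror_eq_one, mirror_eq_neg_one, mirror_eq_neg_one,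
      show -u - (k + 1) = -u - k - 1 by ring, h.pos_iff,
      show -u - k - 1 + 1 = -u - k by ring, show -(u + 1) - k = -u - k - 1 by ring]

theorem pos_of_le (h : IsEvolution W) {k t u : ℤ} (hkt : k ≤ t) (hu : W t u = 1) : W k u = 1 := by
  induction t, hkt using Int.leInduction with
  | base => exact hu
  | succ t _ ih => exact ih ((h.pos_iff t u).1 hu).1

theorem pos_of_not_collide (h : IsEvolution W) {k t u : ℤ} (hkt : k ≤ t) (hu : W k u = 1)
    (hc : ∀ s, k ≤ s → s < t → ¬ Collide W s u) : W t u = 1 := by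
  induction t, hkt using Int.leInduction with
  | base => exact hu
  | succ t hkt ih =>
    have := ih fun s hs hst => hc s hs (by lia)
    exact (h.pos_iff t u).2 ⟨this, fun hn => hc t hkt (by lia) ⟨this, hn⟩⟩

theorem not_pos_of_collide (h : IsEvolution W) {k t u : ℤ} (hkt : t < k) (hu : Collide W t u) :
    W k u ≠ 1 := fun hk =>
  ((h.pos_iff t u).1 (h.pos_of_le (by lia) hk)).2 hu.2

theorem neg_of_le (h : IsEvolution W) {k t v : ℤ} (hkt : k ≤ t) (hv : W t v = -1) :
    W k (v + (t - k)) = -1 := by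
  have := h.mirror.pos_of_le (u := -v - t) hkt (by
    rw [mirror_eq_one, show -(-v - t) - t = v by ring, hv])
  rwa [mirror_eq_one, show -(-v - t) - k = v + (t - k) by ring] at this

end IsEvolution

/-! ### Separated evolutions are determined by their annihilations. -/

/-- An evolution with all positive particles to the left of all negative ones, and infinitely many
of both. -/
structure IsSeparated (W : ℤ → ℤ → SignType) : Prop extends IsEvolution W where
  lt : ∀ k u v, W k u = 1 → W k v = -1 → u < v
  exists_pos : ∀ k N, ∃ u < N, W k u = 1
  exists_neg : ∀ k N, ∃ v > N, W k v = -1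

namespace IsSeparated

variable {W : ℤ → ℤ → SignType}

theorem mirror (h : IsSeparated W) : IsSeparated (mirror W) where
  toIsEvolution := h.toIsEvolution.mirror
  lt k u v hu hv := by
    rw [mirror_eq_one] at hu
    rw [mirror_eq_neg_one] at hv
    have := h.lt _ _ _ hv hu
    lia
  exists_pos k N := by
    obtain ⟨v, hv, hv'⟩ := h.exists_neg k (-N - k)
    exact ⟨-v - k, by lia, by rw [mirror_eq_one, show -(-v - k) - k = v by ring, hv']⟩
  exists_neg k N := by
    obtain ⟨v, hv, hv'⟩ := h.exists_pos k (-N - k)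
    exact ⟨-v - k, by lia, by rw [mirror_eq_neg_one, show -(-v - k) - k = v by ring, hv']⟩

/-- Induction on the gap `v - u`: it shrinks by one per half unit for as long as both particles
survive, and the loss of either one to the right of or at `u` is itself the required annihilation.
-/
theorem exists_collide_ge (h : IsSeparated W) (n : ℕ) : ∀ k u v, W k u = 1 → W k v = -1 →
    v ≤ u + n → ∃ t u', k ≤ t ∧ u ≤ u' ∧ Collide W t u' := by
  induction n with
  | zero =>
    intro k u v hu hv hle
    have := h.lt _ _ _ hu hv
    lia
  | succ n ih =>
    intro k u v hu hv hle
    by_cases hp : W k (v - 1) = 1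
    · refine ⟨k, v - 1, le_rfl, ?_, hp, by rwa [sub_add_cancel]⟩
      have := h.lt _ _ _ hu hv
      lia
    by_cases hc : Collide W k u
    · exact ⟨k, u, le_rfl, le_rfl, hc⟩
    have hu' := h.pos_of_not_collide (t := k + 1) (by lia) hu fun s hs hst => by
      rwa [show s = k by lia]
    have hv' : W (k + 1) (v - 1) = -1 := (h.neg_iff _ _).2 ⟨by rwa [sub_add_cancel], hp⟩
    obtain ⟨t, u', ht, hu'', hc'⟩ := ih _ _ _ hu' hv' (by push_cast at hle; lia)
    exact ⟨t, u', by lia, hu'', hc'⟩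

/-- Annihilations keep occurring at sites `≥ u`. If one occurs at `u' ≠ u`, separation leaves only
positive particles strictly to the left of `u'` afterwards, so the bound on how far they reach
beyond `u` drops. -/
theorem exists_collide_of_pos_of_le (h : IsSeparated W) (n : ℕ) : ∀ k u, W k u = 1 →
    (∀ u', W k u' = 1 → u' ≤ u + n) → ∃ t ≥ k, Collide W t u := by
  induction n with
  | zero =>
    intro k u hu hle
    obtain ⟨v, _, hv⟩ := h.exists_neg k u
    obtain ⟨t, u', ht, hu', hc⟩ := h.exists_collide_ge (v - u).toNat k u v hu hv (by lia)
    have := hle u' (h.pos_of_le ht hc.1)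
    obtain rfl : u' = u := by push_cast at this; lia
    exact ⟨t, ht, hc⟩
  | succ n ih =>
    intro k u hu hle
    by_contra! hnc
    obtain ⟨v, _, hv⟩ := h.exists_neg k u
    obtain ⟨t, u', ht, hu', hc⟩ := h.exists_collide_ge (v - u).toNat k u v hu hv (by lia)
    have hu1 : W (t + 1) u = 1 := h.pos_of_not_collide (by lia) hu fun s hs _ => hnc s hs
    have hb := hle u' (h.pos_of_le ht hc.1)
    obtain ⟨s, hs, hs'⟩ := ih (t + 1) u hu1 fun w hw => by
      have h1 := h.lt t w (u' + 1) (h.pos_of_le (by lia) hw) hc.2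
      have h2 : w ≠ u' := by
        rintro rfl
        exact h.not_pos_of_collide (k := t + 1) (by lia) hc hw
      push_cast at hb
      lia
    exact hnc s (by lia) hs'

theorem pos_iff_exists_collide (h : IsSeparated W) {k u : ℤ} :
    W k u = 1 ↔ ∃ t ≥ k, Collide W t u := by
  constructor
  · intro hu
    obtain ⟨v, hv, hv'⟩ := h.exists_neg k u
    refine h.exists_collide_of_pos_of_le (v - u).toNat k u hu fun u' hu' => ?_
    have := h.lt _ _ _ hu' hv'
    lia
  · rintro ⟨t, ht, hc⟩
    exact h.pos_of_le ht hc.1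

/-- Mirror image of the positive case. A negative particle at `v` at time `k` stands at `v - (t -
k)` at time `t`, one site to the right of its partner. -/
theorem neg_iff_exists_collide (h : IsSeparated W) {k v : ℤ} :
    W k v = -1 ↔ ∃ t ≥ k, Collide W t (v + k - t - 1) := by
  have := h.mirror.pos_iff_exists_collide (k := k) (u := -v - k)
  rw [mirror_eq_one, show -(-v - k) - k = v by ring] at this
  rw [this]
  refine exists_congr fun t => and_congr_right fun _ => ?_
  rw [collide_mirror, show -(-v - k) - 1 - t = v + k - t - 1 by ring]

theorem ext_collide {W' : ℤ → ℤ → SignType} (h : IsSeparated W) (h' : IsSeparated W')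
    (hc : ∀ k u, Collide W k u ↔ Collide W' k u) : W = W' := by
  ext k u : 2
  by_cases h1 : W k u = 1
  · rw [h1, eq_comm, h'.pos_iff_exists_collide]
    simpa only [hc] using h.pos_iff_exists_collide.1 h1
  by_cases h2 : W k u = -1
  · rw [h2, eq_comm, h'.neg_iff_exists_collide]
    simpa only [hc] using h.neg_iff_exists_collide.1 h2
  rw [sign_eq_zero h1 h2, eq_comm]
  refine sign_eq_zero (fun h3 => h1 ?_) fun h3 => h2 ?_
  · rw [h.pos_iff_exists_collide]
    simpa only [hc] using h'.pos_iff_exists_collide.1 h3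
  · rw [h.neg_iff_exists_collide]
    simpa only [hc] using h'.neg_iff_exists_collide.1 h3

theorem collide_unique (h : IsSeparated W) {k u u' : ℤ} (hu : Collide W k u)
    (hu' : Collide W k u') : u = u' := by
  have h1 := h.lt _ _ _ hu.1 hu'.2
  have h2 := h.lt _ _ _ hu'.1 hu.2
  lia

theorem exists_collide_after (h : IsSeparated W) (k : ℤ) : ∃ t ≥ k, ∃ u, Collide W t u := by
  obtain ⟨u, _, hu⟩ := h.exists_pos k 0
  obtain ⟨t, ht, hc⟩ := h.pos_iff_exists_collide.1 hu
  exact ⟨t, ht, u, hc⟩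

end IsSeparated

/-! ### Paths in the moving frame and their turns. -/

/-- A path with steps `± 1/2` per half unit of time, in the frame moving to the right. -/
def IsPath (g : ℤ → ℤ) : Prop := ∀ k, g (k + 1) = g k ∨ g (k + 1) = g k - 1

/-- Second class paths in the moving frame. -/
structure IsSecondClass (W : ℤ → ℤ → SignType) (g : ℤ → ℤ) : Prop where
  collide : ∀ k u, Collide W k u → g (k + 1) = u
  neg : ∀ k, W k (g k) = -1 → g (k + 1) = g k - 1
  zero : ∀ k, W k (g k) = 0 → g (k + 1) = g k

/-- The path makes infinitely many steps in both directions, in the past and in the future. -/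
structure IsOscillating (g : ℤ → ℤ) : Prop where
  left_after : ∀ N, ∃ k > N, g (k + 1) = g k - 1
  right_after : ∀ N, ∃ k > N, g (k + 1) = g k
  left_before : ∀ N, ∃ k < N, g (k + 1) = g k - 1
  right_before : ∀ N, ∃ k < N, g (k + 1) = g k

/-- The path turns from left to right at time `k + 1`. -/
def IsTurn (g : ℤ → ℤ) (k : ℤ) : Prop := g (k + 1) = g k - 1 ∧ g (k + 1 + 1) = g (k + 1)

namespace IsPath

variable {g : ℤ → ℤ}

theorem antitone (hg : IsPath g) {k t : ℤ} (hkt : k ≤ t) : g t ≤ g k := by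
  induction t, hkt using Int.leInduction with
  | base => rfl
  | succ t _ ih => rcases hg t with h | h <;> lia

theorem add_mono (hg : IsPath g) {k t : ℤ} (hkt : k ≤ t) : g k + k ≤ g t + t := by
  induction t, hkt using Int.leInduction with
  | base => rfl
  | succ t _ ih => rcases hg t with h | h <;> lia

/-- After a step to the left, the first turn to the right ends the run. -/
theorem exists_turn (hg : IsPath g) (hr : ∀ N, ∃ k > N, g (k + 1) = g k) {k : ℤ}
    (hk : g (k + 1) = g k - 1) : ∃ t ≥ k, IsTurn g t ∧ g t + t = g k + k := by
  obtain ⟨s, hs, hs'⟩ := hr k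
  obtain ⟨n, rfl⟩ : ∃ n : ℕ, s = k + 1 + n := ⟨(s - k - 1).toNat, by lia⟩
  induction n generalizing k with
  | zero =>
    refine ⟨k, le_rfl, ⟨hk, ?_⟩, rfl⟩
    simpa using hs'
  | succ n ih =>
    rcases hg (k + 1) with h | h
    · exact ⟨k, le_rfl, ⟨hk, h⟩, rfl⟩
    · obtain ⟨t, ht, ht', h2⟩ := ih h (by lia) (by
        rwa [show k + 1 + 1 + (n : ℤ) = k + 1 + (n + 1 : ℕ) by push_cast; ring])
      exact ⟨t, by lia, ht', by lia⟩

theorem exists_turn_after (hg : IsPath g) (ho : IsOscillating g) (N : ℤ) : ∃ t > N, IsTurn g t := by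
  obtain ⟨k, hk, hk'⟩ := ho.left_after N
  obtain ⟨t, ht, h, -⟩ := hg.exists_turn ho.right_after hk'
  exact ⟨t, by lia, h⟩

/-- A turn separates any left step from a later right step, and such a pair of steps exists
arbitrarily far back. -/
theorem exists_turn_before (hg : IsPath g) (ho : IsOscillating g) (N : ℤ) :
    ∃ t < N, IsTurn g t := by
  obtain ⟨s, hs, hs'⟩ := ho.right_before N
  obtain ⟨k, hk, hk'⟩ := ho.left_before s
  by_contra! hn
  have : ∀ t, k ≤ t → t ≤ s → g (t + 1) = g t - 1 := by
    intro t hkt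
    induction t, hkt using Int.leInduction with
    | base => exact fun _ => hk'
    | succ t _ ih =>
      intro hts
      have := ih (by lia)
      exact (hg (t + 1)).resolve_left fun h => hn t (by lia) ⟨this, h⟩
  have := this s hk.le le_rfl
  lia

theorem exists_lt (hg : IsPath g) (ho : IsOscillating g) (N : ℤ) : ∃ k, g k < N := by
  by_contra! hN
  have : ∀ n : ℕ, ∃ k, g k ≤ g 0 - n := by
    intro n
    induction n with
    | zero => exact ⟨0, by simp⟩
    | succ n ih =>
      obtain ⟨k, hk⟩ := ih
      obtain ⟨t, ht, ht'⟩ := ho.left_after k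
      have := hg.antitone ht.le
      exact ⟨t + 1, by push_cast; lia⟩
  obtain ⟨k, hk⟩ := this (g 0 - N + 1).toNat
  have := hN k
  have := hN 0
  lia

theorem exists_gt (hg : IsPath g) (ho : IsOscillating g) (N : ℤ) : ∃ k, N < g k + k := by
  by_contra! hN
  have : ∀ n : ℕ, ∃ k, g 0 + n ≤ g k + k := by
    intro n
    induction n with
    | zero => exact ⟨0, by simp⟩
    | succ n ih =>
      obtain ⟨k, hk⟩ := ih
      obtain ⟨t, ht, ht'⟩ := ho.right_after k
      have := hg.add_mono ht.le
      exact ⟨t + 1, by push_cast; lia⟩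
  obtain ⟨k, hk⟩ := this (N - g 0 + 1).toNat
  have := hN k
  have := hN 0
  lia

end IsPath

/-! ### The evolution generated by the turns of a path. -/

open Classical in
/-- The evolution with annihilations at the turns of the path `g` from left to right. -/
noncomputable def evolutionOf (g : ℤ → ℤ) (k u : ℤ) : SignType :=
  if ∃ t ≥ k, IsTurn g t ∧ g (t + 1) = u then 1
  else if ∃ t ≥ k, IsTurn g t ∧ g t + t = u + k then -1
  else 0

namespace IsPath

variable {g : ℤ → ℤ}

theorem evolutionOf_eq_one {k u : ℤ} :
    evolutionOf g k u = 1 ↔ ∃ t ≥ k, IsTurn g t ∧ g (t + 1) = u := by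
  unfold evolutionOf
  split_ifs <;> simp_all

theorem lt_of_turn (hg : IsPath g) {k t u : ℤ} (ht : t ≥ k) (h : IsTurn g t)
    (hu : g (t + 1) = u) : u < g k := by
  have := hg.antitone ht
  have := h.1
  lia

theorem le_of_turn (hg : IsPath g) {k t v : ℤ} (ht : t ≥ k) (hv : g t + t = v + k) : g k ≤ v := by
  have := hg.add_mono ht
  lia

/-- The two cases in `evolutionOf` exclude each other: positive particles sit strictly to the left
of `g k`, negative ones at `g k` or to its right. -/
theorem evolutionOf_eq_neg_one (hg : IsPath g) {k v : ℤ} :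
    evolutionOf g k v = -1 ↔ ∃ t ≥ k, IsTurn g t ∧ g t + t = v + k := by
  unfold evolutionOf
  split_ifs with h1 h2
  · obtain ⟨t, ht, htt, htu⟩ := h1
    have h3 := hg.lt_of_turn ht htt htu
    refine iff_of_false (by decide) ?_
    rintro ⟨s, hs, hst, hsv⟩
    have h4 := hg.le_of_turn hs hsv
    lia
  · simpa using h2
  · exact iff_of_false (by decide) h2

theorem collide_evolutionOf (hg : IsPath g) {k u : ℤ} :
    Collide (evolutionOf g) k u ↔ IsTurn g k ∧ g (k + 1) = u := by
  rw [Collide, evolutionOf_eq_one, hg.evolutionOf_eq_neg_one]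
  constructor
  · rintro ⟨⟨t, ht, htt, htu⟩, s, hs, hst, hsv⟩
    have h1 := hg.lt_of_turn ht htt htu
    have h2 := hg.le_of_turn hs hsv
    -- The bounds give `g k = u + 1`. A turn at `t > k` that ends in `u` would make the path stay at
    -- time `k`, whereas the turn `s` of the negative particle requires a left step there.
    obtain rfl : t = k := by
      by_contra hne
      have h3 := hg.antitone (show k ≤ k + 1 by lia)
      have h4 := hg.antitone (show k + 1 ≤ t by lia)
      have h5 := htt.1
      by_cases hsk : s = k
      · subst hsk
        have := hst.1
        lia
      · have := hg.add_mono (show k + 1 ≤ s by lia)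
        lia
    exact ⟨htt, htu⟩
  · rintro ⟨hk, rfl⟩
    exact ⟨⟨k, le_rfl, hk, rfl⟩, k, le_rfl, hk, by have := hk.1; lia⟩

theorem isSeparated_evolutionOf (hg : IsPath g) (ho : IsOscillating g) :
    IsSeparated (evolutionOf g) where
  pos_iff k u := by
    constructor
    · intro h
      obtain ⟨t, ht, htt, htu⟩ := evolutionOf_eq_one.1 h
      have h1 : evolutionOf g k u = 1 := evolutionOf_eq_one.2 ⟨t, by lia, htt, htu⟩
      refine ⟨h1, fun h2 => ?_⟩
      obtain ⟨-, h3⟩ := hg.collide_evolutionOf.1 ⟨h1, h2⟩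
      have := hg.lt_of_turn ht htt htu
      lia
    · rintro ⟨h, hn⟩
      obtain ⟨t, ht, htt, htu⟩ := evolutionOf_eq_one.1 h
      refine evolutionOf_eq_one.2 ⟨t, ?_, htt, htu⟩
      by_contra hlt
      obtain rfl : t = k := by lia
      exact hn (hg.collide_evolutionOf.2 ⟨htt, htu⟩).2
  neg_iff k u := by
    constructor
    · intro h
      obtain ⟨t, ht, htt, htu⟩ := hg.evolutionOf_eq_neg_one.1 h
      have h1 : evolutionOf g k (u + 1) = -1 :=
        hg.evolutionOf_eq_neg_one.2 ⟨t, by lia, htt, by lia⟩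
      refine ⟨h1, fun h2 => ?_⟩
      obtain ⟨h4, h3⟩ := hg.collide_evolutionOf.1 ⟨h2, h1⟩
      by_cases h5 : t = k + 1
      · subst h5
        have := htt.1
        have := h4.2
        lia
      · have h6 := hg.add_mono (show k + 1 + 1 ≤ t by lia)
        have := h4.2
        lia
    · rintro ⟨h, hn⟩
      obtain ⟨t, ht, htt, htu⟩ := hg.evolutionOf_eq_neg_one.1 h
      refine hg.evolutionOf_eq_neg_one.2 ⟨t, ?_, htt, by lia⟩
      by_contra hlt
      obtain rfl : t = k := by lia
      exact hn (hg.collide_evolutionOf.2 ⟨htt, by have := htt.1; lia⟩).1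
  lt k u v hu hv := by
    obtain ⟨t, ht, htt, htu⟩ := evolutionOf_eq_one.1 hu
    obtain ⟨s, hs, hst, hsv⟩ := hg.evolutionOf_eq_neg_one.1 hv
    exact (hg.lt_of_turn ht htt htu).trans_le (hg.le_of_turn hs hsv)
  exists_pos k N := by
    obtain ⟨s, hs⟩ := hg.exists_lt ho N
    obtain ⟨t, ht, htt⟩ := hg.exists_turn_after ho (max k s)
    have := hg.antitone (show s ≤ t + 1 by lia)
    exact ⟨g (t + 1), by lia, evolutionOf_eq_one.2 ⟨t, by lia, htt, rfl⟩⟩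
  exists_neg k N := by
    obtain ⟨s, hs⟩ := hg.exists_gt ho (N + k)
    obtain ⟨t, ht, htt⟩ := hg.exists_turn_after ho (max k s)
    have := hg.add_mono (show s ≤ t by lia)
    exact ⟨g t + t - k, by lia, hg.evolutionOf_eq_neg_one.2 ⟨t, by lia, htt, by ring⟩⟩

theorem isSecondClass_evolutionOf (hg : IsPath g) (ho : IsOscillating g) :
    IsSecondClass (evolutionOf g) g where
  collide k u h := (hg.collide_evolutionOf.1 h).2
  neg k h := by
    obtain ⟨t, ht, htt, htu⟩ := hg.evolutionOf_eq_neg_one.1 h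
    refine (hg k).resolve_left fun h1 => ?_
    by_cases h2 : t = k
    · subst h2
      have := htt.1
      lia
    · have := hg.add_mono (show k + 1 ≤ t by lia)
      lia
  zero k h := by
    refine (hg k).resolve_right fun h1 => ?_
    obtain ⟨t, ht, htt, h2⟩ := hg.exists_turn ho.right_after h1
    have := hg.evolutionOf_eq_neg_one.2 ⟨t, ht, htt, h2⟩
    rw [h] at this
    exact absurd this (by decide)

end IsPath

/-! ### Uniqueness and existence of second-class paths. -/

namespace IsSecondClass

variable {W : ℤ → ℤ → SignType} {g : ℤ → ℤ}

theorem le_of_pos (hs : IsSecondClass W g) (hW : IsSeparated W) (hg : IsPath g) {k u : ℤ}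
    (hu : W k u = 1) : u ≤ g k := by
  obtain ⟨t, ht, hc⟩ := hW.pos_iff_exists_collide.1 hu
  have h1 := hs.collide _ _ hc
  have h2 := hg.antitone (show k ≤ t + 1 by lia)
  lia

/-- A path found on a positive particle must already have been riding it. Had it come by a left
step, its previous site would have held another positive particle, which would survive to the right
of the path, against `le_of_pos`. -/
theorem pos_pred (hs : IsSecondClass W g) (hW : IsSeparated W) (hg : IsPath g) {k : ℤ}
    (h : W (k + 1) (g (k + 1)) = 1) : g (k + 1) = g k ∧ W k (g k) = 1 := by
  have h1 := (hW.pos_iff k _).1 h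
  rcases hg k with hk | hk
  · exact ⟨hk, hk ▸ h1.1⟩
  · exfalso
    rw [hk, sub_add_cancel] at h1
    have h2 : W k (g k) ≠ 0 := fun h2 => by
      have := hs.zero k h2
      lia
    have h3 : W k (g k) = 1 := by
      by_contra h3
      exact h2 (sign_eq_zero h3 h1.2)
    have h4 : W (k + 1) (g k) = 1 := (hW.pos_iff _ _).2 ⟨h3, fun h5 => by
      have := hs.collide k _ ⟨h3, h5⟩
      lia⟩
    have := hs.le_of_pos hW hg h4
    lia

/-- Equality would mean riding one positive particle through the entire past, without any left step.
-/
theorem lt_of_pos (hs : IsSecondClass W g) (hW : IsSeparated W) (hg : IsPath g)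
    (ho : IsOscillating g) {k u : ℤ} (hu : W k u = 1) : u < g k := by
  refine (hs.le_of_pos hW hg hu).lt_of_ne ?_
  rintro rfl
  have key : ∀ n : ℕ, W (k - n) (g (k - n)) = 1 := by
    intro n
    induction n with
    | zero => simpa using hu
    | succ n ih =>
      rw [show k - (n : ℤ) = k - (n + 1 : ℕ) + 1 by push_cast; ring] at ih
      exact (hs.pos_pred hW hg ih).2
  obtain ⟨t, ht, ht'⟩ := ho.left_before k
  have h1 := key (k - (t + 1)).toNat
  rw [show k - ((k - (t + 1)).toNat : ℤ) = t + 1 by lia] at h1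
  have := (hs.pos_pred hW hg h1).1
  lia

theorem collide_iff (hs : IsSecondClass W g) (hW : IsSeparated W) (hg : IsPath g)
    (ho : IsOscillating g) {k u : ℤ} : Collide W k u ↔ IsTurn g k ∧ g (k + 1) = u := by
  constructor
  · intro h
    have h1 := hs.collide _ _ h
    have h2 := hs.lt_of_pos hW hg ho h.1
    have h3 : g (k + 1) = g k - 1 := (hg k).resolve_left (by lia)
    refine ⟨⟨h3, hs.zero _ ?_⟩, h1⟩
    rw [h1]
    refine sign_eq_zero (hW.not_pos_of_collide (by lia) h) fun h4 => ?_
    exact ((hW.neg_iff _ _).1 h4).2 h.1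
  · rintro ⟨ht, rfl⟩
    have h1 : W k (g k) = -1 := by
      by_contra h1
      have h2 : W k (g k) ≠ 1 := fun h2 => lt_irrefl _ (hs.lt_of_pos hW hg ho h2)
      have := hs.zero k (sign_eq_zero h2 h1)
      have := ht.1
      lia
    have h2 : W k (g k - 1) = 1 := by
      by_contra h2
      have h3 : W (k + 1) (g k - 1) = -1 := (hW.neg_iff _ _).2 ⟨by rwa [sub_add_cancel], h2⟩
      rw [← ht.1] at h3
      have := hs.neg _ h3
      have := ht.2
      lia
    rw [ht.1]
    exact ⟨h2, by rwa [sub_add_cancel]⟩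

theorem eq_evolutionOf (hs : IsSecondClass W g) (hW : IsSeparated W) (hg : IsPath g)
    (ho : IsOscillating g) : W = evolutionOf g :=
  hW.ext_collide (hg.isSeparated_evolutionOf ho) fun k u => by
    rw [hs.collide_iff hW hg ho, hg.collide_evolutionOf]

/-- A second class path is determined from the first annihilation on. -/
theorem eq_of_collide {g' : ℤ → ℤ} (hs : IsSecondClass W g) (hs' : IsSecondClass W g')
    (hW : IsSeparated W) {k u t : ℤ} (hc : Collide W k u) (ht : k < t) : g t = g' t := by
  have key : g t = g' t ∧ W t (g t) ≠ 1 := by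
    induction t, (show k + 1 ≤ t by lia) using Int.leInduction with
    | base =>
      rw [hs.collide _ _ hc, hs'.collide _ _ hc]
      exact ⟨rfl, hW.not_pos_of_collide (by lia) hc⟩
    | succ t hkt ih =>
      obtain ⟨h1, h2⟩ := ih (by lia)
      by_cases h3 : W t (g t) = -1
      · rw [hs.neg _ h3, hs'.neg _ (h1 ▸ h3), h1]
        refine ⟨rfl, fun h4 => ((hW.pos_iff _ _).1 h4).2 ?_⟩
        rw [sub_add_cancel, ← h1, h3]
      · have h3 := sign_eq_zero h2 h3
        rw [hs.zero _ h3, hs'.zero _ (h1 ▸ h3)]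
        exact ⟨h1, fun h4 => h2 ((hW.pos_iff _ _).1 h4).1⟩
  exact key.1

theorem unique {g' : ℤ → ℤ} (hs : IsSecondClass W g) (hs' : IsSecondClass W g')
    (hW : IsSeparated W) (hp : ∀ N, ∃ k < N, ∃ u, Collide W k u) : g = g' := by
  ext t
  obtain ⟨k, hk, u, hc⟩ := hp t
  exact hs.eq_of_collide hs' hW hc hk

end IsSecondClass

/-- The path is `min (a k) (j k)`, where `j k` is the leftmost negative particle and `a k` the
leftmost site of a past annihilation. Between annihilations `a` is constant and `j` falls by one, so
the path rests at the last annihilation site until the leftmost negative particle reaches it, then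
follows that particle to the next annihilation. -/
theorem IsSeparated.exists_isSecondClass {W : ℤ → ℤ → SignType} (hW : IsSeparated W)
    (hp : ∀ N, ∃ k < N, ∃ u, Collide W k u) :
    ∃ g, IsPath g ∧ IsOscillating g ∧ IsSecondClass W g := by
  have hj : ∀ k, ∃ j, W k j = -1 ∧ ∀ v, W k v = -1 → j ≤ v := fun k => by
    obtain ⟨u, _, hu⟩ := hW.exists_pos k 0
    obtain ⟨v, _, hv⟩ := hW.exists_neg k 0
    exact Int.exists_least_of_bdd ⟨u, fun v hv => (hW.lt _ _ _ hu hv).le⟩ ⟨v, hv⟩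
  choose j hj hjm using hj
  have ha : ∀ k, ∃ a, (∃ t < k, Collide W t a) ∧ ∀ u, (∃ t < k, Collide W t u) → a ≤ u := fun k => by
    obtain ⟨u, _, hu⟩ := hW.exists_pos k 0
    obtain ⟨t, ht, w, hc⟩ := hp k
    refine Int.exists_least_of_bdd ⟨u, ?_⟩ ⟨w, t, ht, hc⟩
    rintro v ⟨s, hs, hv⟩
    have := hW.lt _ _ _ (hW.pos_of_le hs.le hu) hv.2
    lia
  choose a ha ham using ha
  have ha_gt : ∀ k u, W k u = 1 → u < a k := fun k u hu => by
    obtain ⟨t, ht, hc⟩ := ha k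
    have h1 := hW.lt _ _ _ (hW.pos_of_le ht.le hu) hc.2
    have h2 : u ≠ a k := by
      rintro rfl
      exact hW.not_pos_of_collide ht hc hu
    lia
  have hj_collide : ∀ k u, Collide W k u → j k = u + 1 := fun k u hc => by
    have h1 := hjm _ _ hc.2
    have h2 := hW.lt _ _ _ hc.1 (hj k)
    lia
  have ha_collide : ∀ k u, Collide W k u → a (k + 1) = u := fun k u hc => by
    have h1 := ham (k + 1) u ⟨k, by lia, hc⟩
    obtain ⟨t, ht, hc'⟩ := ha (k + 1)
    by_cases h2 : t = k
    · subst h2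
      exact hW.collide_unique hc' hc
    · have := ham k (a (k + 1)) ⟨t, by lia, hc'⟩
      have := ha_gt k u hc.1
      lia
  have ha_free : ∀ k, (∀ u, ¬ Collide W k u) → a (k + 1) = a k := fun k hn => by
    refine le_antisymm (ham _ _ ?_) (ham _ _ ?_)
    · obtain ⟨t, ht, hc⟩ := ha k
      exact ⟨t, by lia, hc⟩
    · obtain ⟨t, ht, hc⟩ := ha (k + 1)
      refine ⟨t, lt_of_le_of_ne (by lia) ?_, hc⟩
      rintro rfl
      exact hn _ hc
  have hj_free : ∀ k, (∀ u, ¬ Collide W k u) → j (k + 1) = j k - 1 := fun k hn => by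
    refine le_antisymm (hjm _ _ ?_) ?_
    · exact (hW.neg_iff _ _).2 ⟨by rw [sub_add_cancel, hj], fun h => hn _ ⟨h, by
        rw [sub_add_cancel, hj]⟩⟩
    · have := hjm _ _ ((hW.neg_iff _ _).1 (hj (k + 1))).1
      lia
  have hj_lower : ∀ k u, Collide W k u → u < j (k + 1) := fun k u hc => by
    have h1 := (hW.neg_iff _ _).1 (hj (k + 1))
    have h2 := hjm _ _ h1.1
    have h3 := hj_collide _ _ hc
    have h4 : j (k + 1) ≠ u := by
      intro h
      rw [h] at h1
      exact h1.2 hc.1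
    lia
  have hstep : ∀ k u, Collide W k u →
      min (a k) (j k) = u + 1 ∧ min (a (k + 1)) (j (k + 1)) = u := fun k u hc => by
    have h1 := ha_gt _ _ hc.1
    have h2 := hj_collide _ _ hc
    have h3 := ha_collide _ _ hc
    have h4 := hj_lower _ _ hc
    lia
  have hpath : IsPath fun k => min (a k) (j k) := fun k => by
    by_cases hc : ∃ u, Collide W k u
    · obtain ⟨u, hc⟩ := hc
      obtain ⟨h1, h2⟩ := hstep _ _ hc
      right
      simp only [h1, h2]
      ring
    · push Not at hc
      have h1 := ha_free k hc
      have h2 := hj_free k hc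
      simp only
      lia
  have hsc : IsSecondClass W fun k => min (a k) (j k) := by
    refine ⟨fun k u hc => (hstep _ _ hc).2, fun k hk => ?_, fun k hk => ?_⟩
    · by_cases hc : ∃ u, Collide W k u
      · obtain ⟨u, hc⟩ := hc
        have := hstep _ _ hc
        lia
      · push Not at hc
        have h1 := ha_free k hc
        have h2 := hj_free k hc
        have h3 := hjm _ _ hk
        lia
    · have h3 : min (a k) (j k) ≠ j k := fun h => by
        simp only [h, hj] at hk
        exact absurd hk (by decide)
      have hc : ∀ u, ¬ Collide W k u := fun u hc => by
        have := hstep _ _ hc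
        have := hj_collide _ _ hc
        lia
      have h1 := ha_free k hc
      have h2 := hj_free k hc
      lia
  have hleft : ∀ k u, Collide W k u →
      min (a (k + 1)) (j (k + 1)) = min (a k) (j k) - 1 := fun k u hc => by
    have := hstep _ _ hc
    lia
  have hright : ∀ k u, Collide W k u →
      min (a (k + 1 + 1)) (j (k + 1 + 1)) = min (a (k + 1)) (j (k + 1)) := fun k u hc => by
    refine hsc.zero (k + 1) ?_
    simp only [(hstep _ _ hc).2]
    exact sign_eq_zero (hW.not_pos_of_collide (by lia) hc) fun h =>
      ((hW.neg_iff _ _).1 h).2 hc.1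
  refine ⟨_, hpath, ⟨fun N => ?_, fun N => ?_, fun N => ?_, fun N => ?_⟩, hsc⟩
  · obtain ⟨t, ht, u, hc⟩ := hW.exists_collide_after (N + 1)
    exact ⟨t, by lia, hleft _ _ hc⟩
  · obtain ⟨t, ht, u, hc⟩ := hW.exists_collide_after (N + 1)
    exact ⟨t + 1, by lia, hright _ _ hc⟩
  · obtain ⟨t, ht, u, hc⟩ := hp N
    exact ⟨t, by lia, hleft _ _ hc⟩
  · obtain ⟨t, ht, u, hc⟩ := hp (N - 1)
    exact ⟨t + 1, by lia, hright _ _ hc⟩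

theorem sign_ext {a b : SignType} (h₁ : a = 1 ↔ b = 1) (h₂ : a = -1 ↔ b = -1) : a = b := by
  revert a b; decide

theorem sign_neg_eq_zero {s : SignType} : -s = 0 ↔ s = 0 := by
  revert s; decide

/-! ### From unique converging pairs to separation. -/

section Separation

theorem exists_isConvergingPair {ζ : Config} {u z : ℤ} (hu : ζ u = 1) (hz : ζ z = -1)
    (huz : u < z) : ∃ i j, IsConvergingPair ζ (i, j) ∧ u ≤ i ∧ j ≤ z := by
  obtain ⟨i, ⟨hi, hiz⟩, him⟩ := Int.exists_greatest_of_bdd (P := fun i => ζ i = 1 ∧ i < z)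
    ⟨z, fun i hi => hi.2.le⟩ ⟨u, hu, huz⟩
  obtain ⟨j, ⟨hj, hij⟩, hjm⟩ := Int.exists_least_of_bdd (P := fun j => ζ j = -1 ∧ i < j)
    ⟨i, fun j hj => hj.2.le⟩ ⟨z, hz, hiz⟩
  have hjz := hjm z ⟨hz, hiz⟩
  refine ⟨i, j, ⟨hij, hi, hj, fun k hik hkj => sign_eq_zero (fun h => ?_) fun h => ?_⟩,
    him u ⟨hu, huz⟩, hjz⟩
  · have := him k ⟨h, lt_of_lt_of_le hkj hjz⟩
    exact absurd hik (not_lt.2 this)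
  · have := hjm k ⟨h, hik⟩
    exact absurd hkj (not_lt.2 this)

variable {W : ℤ → ℤ → SignType}

/-- The negative particle crosses the empty sites unhindered and is next to `i` after `j - i - 1`
half units, so a positive particle still at `i` is annihilated in the next one. -/
theorem IsEvolution.not_pos_of_isConvergingPair (h : IsEvolution W) {k t i j : ℤ}
    (hp : IsConvergingPair (W k) (i, j)) (ht : k + (j - i) ≤ t) : W t i ≠ 1 := by
  obtain ⟨hij, hi, hj, hz⟩ := hp
  simp only at hij hi hj hz
  have key : ∀ n : ℕ, (n : ℤ) < j - i → W (k + n) (j - n) = -1 := by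
    intro n
    induction n with
    | zero => simpa using fun _ => hj
    | succ n ih =>
      intro hn
      have h1 := ih (by push_cast at hn; lia)
      push_cast at hn ⊢
      rw [← add_assoc, h.neg_iff]
      refine ⟨by rwa [show j - ((n : ℤ) + 1) + 1 = j - n by ring], fun h2 => ?_⟩
      have h3 := h.pos_of_le (k := k) (by lia) h2
      rw [hz _ (by lia) (by lia)] at h3
      exact absurd h3 (by decide)
  intro hti
  have h1 := key (j - i - 1).toNat (by lia)
  rw [show k + ((j - i - 1).toNat : ℤ) = k + (j - i) - 1 by lia,
    show j - ((j - i - 1).toNat : ℤ) = i + 1 by lia] at h1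
  have h2 := h.pos_of_le (k := k + (j - i) - 1 + 1) (by lia) hti
  exact ((h.pos_iff _ _).1 h2).2 h1

/-- Infinite descent. Once the pair `(i, j)` is gone, a new one `(i', j')` takes over; its particles
were present before, so by uniqueness of the old pair `i' ≤ i`, and `i' ≠ i` since the particle at
`i` has died. The positive member thus moves strictly to the left and passes any `N`. -/
theorem IsEvolution.exists_pos_lt (h : IsEvolution W)
    (hu : ∀ n, ∃! p, IsConvergingPair (W (2 * n)) p) (n N : ℤ) : ∃ u < N, W (2 * n) u = 1 := by
  by_contra! hN
  have key : ∀ m : ℕ, ∀ n' ≥ n, ∀ i j, IsConvergingPair (W (2 * n')) (i, j) → ¬ i < N + m := by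
    intro m
    induction m with
    | zero =>
      intro n' hn' i j hp hi
      exact hN i (by simpa using hi) (h.pos_of_le (by lia) hp.2.1)
    | succ m ih =>
      intro n' hn' i j hp hi
      have hij : i < j := hp.1
      obtain ⟨⟨i', j'⟩, hp', -⟩ := hu (n' + (j - i))
      have hij' : i' < j' := hp'.1
      have h1 := h.pos_of_le (k := 2 * n') (by lia) hp'.2.1
      have h2 := h.neg_of_le (k := 2 * n') (by lia) hp'.2.2.1
      obtain ⟨p, q, hpq, hip, -⟩ := exists_isConvergingPair h1 h2 (by simp only; lia)
      obtain ⟨rfl, rfl⟩ := Prod.mk.inj ((hu n').unique hpq hp)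
      have h3 : i' ≠ p := by
        rintro rfl
        exact h.not_pos_of_isConvergingPair hp (by lia) hp'.2.1
      refine ih (n' + (q - p)) (by lia) i' j' hp' ?_
      push_cast at hi
      simp only at hip
      lia
  obtain ⟨⟨i, j⟩, hp, -⟩ := hu n
  exact key (i - N + 1).toNat n le_rfl i j hp (by lia)

theorem isConvergingPair_mirror {k i j : ℤ} :
    IsConvergingPair (mirror W k) (i, j) ↔ IsConvergingPair (W k) (-j - k, -i - k) := by
  simp only [IsConvergingPair, mirror_eq_one, mirror_eq_neg_one]
  constructor
  · rintro ⟨h1, h2, h3, h4⟩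
    refine ⟨by lia, h3, h2, fun l hl hl' => ?_⟩
    have := h4 (-l - k) (by lia) (by lia)
    rwa [mirror, show -(-l - k) - k = l by ring, sign_neg_eq_zero] at this
  · rintro ⟨h1, h2, h3, h4⟩
    refine ⟨by lia, h3, h2, fun l hl hl' => ?_⟩
    rw [mirror, h4 _ (by lia) (by lia), neg_zero]

theorem IsEvolution.isSeparated (h : IsEvolution W)
    (hu : ∀ n, ∃! p, IsConvergingPair (W (2 * n)) p) : IsSeparated W := by
  have hpos := h.exists_pos_lt hu
  have hneg : ∀ n N, ∃ v > N, W (2 * n) v = -1 := fun n N => by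
    obtain ⟨u, hu1, hu2⟩ := h.mirror.exists_pos_lt (fun n => by
      obtain ⟨⟨i, j⟩, hp, hun⟩ := hu n
      refine ⟨(-j - 2 * n, -i - 2 * n), ?_, ?_⟩
      · refine isConvergingPair_mirror.2 ?_
        convert hp using 2 <;> ring
      · rintro ⟨i', j'⟩ hp'
        rw [isConvergingPair_mirror] at hp'
        have := Prod.mk.inj (hun _ hp')
        ext <;> simp only <;> lia) n (-N - 2 * n)
    exact ⟨-u - 2 * n, by lia, mirror_eq_one.1 hu2⟩
  -- A negative particle to the left of a positive one, together with a positive one further left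
  -- and a negative one further right, would give two converging pairs.
  have hlt : ∀ n u v, W (2 * n) u = 1 → W (2 * n) v = -1 → u < v := fun n u v hu' hv => by
    by_contra hvu
    have hne : u ≠ v := by
      rintro rfl
      rw [hu'] at hv
      exact absurd hv (by decide)
    obtain ⟨a, ha, ha'⟩ := hpos n v
    obtain ⟨b, hb, hb'⟩ := hneg n u
    obtain ⟨i, j, hp, -, hj⟩ := exists_isConvergingPair ha' hv ha
    obtain ⟨i', j', hp', hi', -⟩ := exists_isConvergingPair hu' hb' hb
    obtain ⟨rfl, rfl⟩ := Prod.mk.inj ((hu n).unique hp hp')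
    have : i < j := hp.1
    lia
  refine ⟨h, fun k u v hu' hv => ?_, fun k N => ?_, fun k N => ?_⟩
  · obtain ⟨n, hn⟩ : ∃ n, 2 * n = k ∨ 2 * n + 1 = k := ⟨k / 2, by lia⟩
    rcases hn with rfl | rfl
    · exact hlt n u v hu' hv
    · rw [h.pos_iff] at hu'
      rw [h.neg_iff] at hv
      have h1 := hlt _ _ _ hu'.1 hv.1
      have h2 : u ≠ v := by
        rintro rfl
        exact hv.2 hu'.1
      lia
  · obtain ⟨u, hu', hu''⟩ := hpos (k / 2 + 1) N
    exact ⟨u, hu', h.pos_of_le (by lia) hu''⟩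
  · obtain ⟨v, hv, hv'⟩ := hneg (k / 2 + 1) N
    exact ⟨_, by lia, h.neg_of_le (k := k) (by lia) hv'⟩

theorem IsSeparated.existsUnique_isConvergingPair (h : IsSeparated W) (k : ℤ) :
    ∃! p, IsConvergingPair (W k) p := by
  obtain ⟨u, hu, hu'⟩ := h.exists_pos k 0
  obtain ⟨v, hv, hv'⟩ := h.exists_neg k 0
  obtain ⟨i, j, hp, -, -⟩ := exists_isConvergingPair hu' hv' (by lia)
  refine ⟨(i, j), hp, ?_⟩
  rintro ⟨i', j'⟩ ⟨h1, h2, h3, h4⟩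
  obtain ⟨h1', h2', h3', h4'⟩ := hp
  simp only at h1 h2 h3 h4 h1' h2' h3' h4'
  have a1 := h.lt _ _ _ h2 h3'
  have a2 := h.lt _ _ _ h2' h3
  have b1 : ¬ i' < i := fun hlt => by
    rw [h4 i hlt a2] at h2'
    exact absurd h2' (by decide)
  have b2 : ¬ i < i' := fun hlt => by
    rw [h4' i' hlt a1] at h2
    exact absurd h2 (by decide)
  have b3 : ¬ j' < j := fun hlt => by
    rw [h4' j' a2 hlt] at h3
    exact absurd h3 (by decide)
  have b4 : ¬ j < j' := fun hlt => by
    rw [h4 j a1 hlt] at h3'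
    exact absurd h3' (by decide)
  ext <;> simp only <;> lia

end Separation

/-! ### Integer coordinates for half-integers. -/

section HalfIntegers

/-- The half-integer `k / 2`. -/
def toHalf (k : ℤ) : HalfInt := k • half

theorem coe_toHalf (k : ℤ) : ((toHalf k : HalfInt) : ℚ) = k / 2 := by
  simp [toHalf, half, div_eq_mul_inv]

theorem toHalf_add_one (k : ℤ) : toHalf (k + 1) = toHalf k + half := by
  simp [toHalf, add_smul]

theorem toHalf_sub_one (k : ℤ) : toHalf (k - 1) = toHalf k - half := by
  simp [toHalf, sub_smul]

theorem toHalf_injective : Function.Injective toHalf := fun a b h => by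
  have := congrArg (fun x : HalfInt => (x : ℚ)) h
  simp only [coe_toHalf] at this
  have h' : (a : ℚ) = b := by linarith
  exact_mod_cast h'

theorem toHalf_surjective : Function.Surjective toHalf := fun x => by
  obtain ⟨k, hk⟩ := AddSubgroup.mem_zmultiples_iff.1 x.2
  exact ⟨k, Subtype.ext (by rw [← hk]; simp [toHalf, half])⟩

theorem isInt_toHalf {k : ℤ} : IsInt (toHalf k) ↔ Even k := by
  simp only [IsInt, coe_toHalf]
  constructor
  · rintro ⟨m, hm⟩
    have h' : (k : ℚ) = (m + m : ℤ) := by push_cast; linarith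
    exact ⟨m, by exact_mod_cast h'⟩
  · rintro ⟨m, rfl⟩
    exact ⟨m, by push_cast; ring⟩

theorem floor_toHalf (k : ℤ) : ⌊((toHalf k : HalfInt) : ℚ)⌋ = k / 2 := by
  rw [coe_toHalf]
  exact_mod_cast Rat.floor_intCast_div_natCast k 2

end HalfIntegers

/-! ### Trajectories as separated evolutions. -/

section Evolution

/-- The evolution of a trajectory, in the moving frame and half units of time. -/
noncomputable def Trajectory.evolution (ω : Trajectory) (k u : ℤ) : SignType :=
  halfRecord ω (toHalf k) (toHalf (2 * u + k))

/-- Hence the index `2 * u + k` in `Trajectory.evolution` misses no particle. -/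
theorem halfRecord_eq_zero (ω : Trajectory) {k l : ℤ} (h : ¬ Even (k + l)) :
    halfRecord ω (toHalf k) (toHalf l) = 0 := by
  rw [Int.even_add] at h
  unfold halfRecord
  simp only [isInt_toHalf]
  split_ifs <;> first | rfl | (exfalso; tauto)

namespace Trajectory

variable (ω : Trajectory)

theorem evolution_even (n u : ℤ) : ω.evolution (2 * n) u = ω n (u + n) := by
  unfold evolution halfRecord
  rw [if_pos (isInt_toHalf.2 (by simp)), if_pos (isInt_toHalf.2 (by simp [Int.even_add])),
    floor_toHalf, floor_toHalf, show 2 * n / 2 = n by lia, show (2 * u + 2 * n) / 2 = u + n by lia]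

open Classical in
theorem evolution_odd (n u : ℤ) : ω.evolution (2 * n + 1) u =
    if ω n (u + n) = 1 ∧ ω n (u + n + 1) ≠ -1 then 1
    else if ω n (u + n + 1) = -1 ∧ ω n (u + n) ≠ 1 then -1 else 0 := by
  unfold evolution halfRecord
  rw [if_neg (fun h => by obtain ⟨m, hm⟩ := isInt_toHalf.1 h; lia),
    if_neg (fun h => by obtain ⟨m, hm⟩ := isInt_toHalf.1 h; lia),
    floor_toHalf, floor_toHalf, show (2 * n + 1) / 2 = n by lia,
    show (2 * u + (2 * n + 1)) / 2 = u + n by lia]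

theorem evolution_odd_eq_one (n u : ℤ) : ω.evolution (2 * n + 1) u = 1 ↔
    ω n (u + n) = 1 ∧ ω n (u + n + 1) ≠ -1 := by
  rw [evolution_odd]
  split_ifs with h1 h2 <;> simp [h1]

theorem evolution_odd_eq_neg_one (n u : ℤ) : ω.evolution (2 * n + 1) u = -1 ↔
    ω n (u + n + 1) = -1 ∧ ω n (u + n) ≠ 1 := by
  rw [evolution_odd]
  split_ifs with h1 h2 <;> simp_all

end Trajectory

/-- A unit step is two half-unit steps: the two brackets say that a positive particle is at `x -
1/2` and a negative one at `x + 1/2` half a unit later. -/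
theorem step_eq_one {ζ : Config} {x : ℤ} : step ζ x = 1 ↔
    (ζ (x - 1) = 1 ∧ ζ x ≠ -1) ∧ ¬ (ζ (x + 1) = -1 ∧ ζ x ≠ 1) := by
  unfold step
  generalize ζ (x - 1) = a, ζ x = b, ζ (x + 1) = c
  revert a b c; decide

theorem step_eq_neg_one {ζ : Config} {x : ℤ} : step ζ x = -1 ↔
    (ζ (x + 1) = -1 ∧ ζ x ≠ 1) ∧ ¬ (ζ (x - 1) = 1 ∧ ζ x ≠ -1) := by
  unfold step
  generalize ζ (x - 1) = a, ζ x = b, ζ (x + 1) = c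
  revert a b c; decide

namespace Trajectory

variable (ω : Trajectory)

theorem isEvolution : IsEvolution ω.evolution := by
  have hs : ∀ n u : ℤ, ω.evolution (2 * n + 1 + 1) u = step (ω n) (u + n + 1) := fun n u => by
    rw [← (ω.2 n).2, show 2 * n + 1 + 1 = 2 * (n + 1) by ring, evolution_even, add_assoc]
  constructor <;> intro k u <;>
    obtain ⟨n, rfl | rfl⟩ : ∃ n, k = 2 * n ∨ k = 2 * n + 1 := ⟨k / 2, by lia⟩
  · rw [evolution_odd_eq_one, evolution_even, evolution_even, add_right_comm]
  · simp only [hs, step_eq_one, evolution_odd_eq_one, ne_eq, evolution_odd_eq_neg_one,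
      add_right_comm u 1 n, add_sub_cancel_right]
  · rw [evolution_odd_eq_neg_one, evolution_even, evolution_even, add_right_comm]
  · simp only [hs, step_eq_neg_one, evolution_odd_eq_neg_one, ne_eq, evolution_odd_eq_one,
      add_right_comm u 1 n, add_sub_cancel_right]

theorem isSeparated : IsSeparated ω.evolution := by
  refine ω.isEvolution.isSeparated fun n => ?_
  obtain ⟨⟨i, j⟩, ⟨h1, h2, h3, h4⟩, hu⟩ := (ω.2 n).1.1
  simp only at h1 h2 h3 h4
  refine ⟨(i - n, j - n), ⟨by simpa using h1, ?_, ?_, fun k hk hk' => ?_⟩, ?_⟩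
  · rw [evolution_even, sub_add_cancel, h2]
  · rw [evolution_even, sub_add_cancel, h3]
  · rw [evolution_even]
    simp only at hk hk'
    exact h4 _ (by lia) (by lia)
  · rintro ⟨i', j'⟩ ⟨h1', h2', h3', h4'⟩
    simp only [evolution_even] at h1' h2' h3' h4'
    have := Prod.mk.inj (hu (i' + n, j' + n) ⟨by simpa using h1', h2', h3', fun k hk hk' => by
      have := h4' (k - n) (by simp only at hk; lia) (by simp only at hk'; lia)
      rwa [sub_add_cancel] at this⟩)
    ext <;> simp only <;> lia

theorem evolution_injective : Function.Injective evolution := fun ω ω' h => by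
  refine Subtype.ext (funext fun n => funext fun x => ?_)
  have := congrFun₂ h (2 * n) (x - n)
  rwa [evolution_even, evolution_even, sub_add_cancel] at this

end Trajectory

/-- The configuration at time `n` of an evolution, back in the frame at rest. -/
def restConfig (W : ℤ → ℤ → SignType) (n : ℤ) : Config := fun x => W (2 * n) (x - n)

theorem IsEvolution.restConfig_succ {W : ℤ → ℤ → SignType} (h : IsEvolution W) (n : ℤ) :
    restConfig W (n + 1) = step (restConfig W n) := by
  ext x : 1
  have e1 : restConfig W (n + 1) x = W (2 * n + 1 + 1) (x - 1 - n) := by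
    unfold restConfig; congr 1 <;> ring
  have e2 : x + 1 - n = x - 1 - n + 1 + 1 := by ring
  have e3 : x - n = x - 1 - n + 1 := by ring
  refine sign_ext ?_ ?_
  · rw [e1]
    simp only [step_eq_one, h.pos_iff, h.neg_iff, restConfig, e2, e3, ne_eq]
  · rw [e1]
    simp only [step_eq_neg_one, h.pos_iff, h.neg_iff, restConfig, e2, e3, ne_eq]

theorem IsSeparated.restConfig_mem {W : ℤ → ℤ → SignType} (h : IsSeparated W) (n : ℤ) :
    restConfig W n ∈ phaseSepConfigs := by
  refine ⟨?_, ?_, ?_⟩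
  · obtain ⟨⟨i, j⟩, ⟨h1, h2, h3, h4⟩, hu⟩ := h.existsUnique_isConvergingPair (2 * n)
    simp only at h1 h2 h3 h4
    refine ⟨(i + n, j + n), ⟨by simpa using h1, ?_, ?_, fun k hk hk' => ?_⟩, ?_⟩
    · simp only [restConfig, add_sub_cancel_right, h2]
    · simp only [restConfig, add_sub_cancel_right, h3]
    · simp only at hk hk'
      exact h4 _ (by lia) (by lia)
    · rintro ⟨i', j'⟩ ⟨h1', h2', h3', h4'⟩
      simp only [restConfig] at h1' h2' h3' h4'
      have := Prod.mk.inj (hu (i' - n, j' - n) ⟨by simpa using h1', h2', h3', fun k hk hk' => by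
        have := h4' (k + n) (by simp only at hk; lia) (by simp only at hk'; lia)
        rwa [add_sub_cancel_right] at this⟩)
      ext <;> simp only <;> lia
  · refine Set.infinite_of_forall_exists_lt fun N => ?_
    obtain ⟨u, hu, hu'⟩ := h.exists_pos (2 * n) (N - n)
    exact ⟨u + n, by simp [restConfig, hu'], by lia⟩
  · refine Set.infinite_of_forall_exists_gt fun N => ?_
    obtain ⟨u, hu, hu'⟩ := h.exists_neg (2 * n) (N - n)
    exact ⟨u + n, by simp [restConfig, hu'], by lia⟩

/-- The trajectory of a separated evolution. -/
def IsSeparated.trajectory {W : ℤ → ℤ → SignType} (h : IsSeparated W) : Trajectory :=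
  ⟨restConfig W, fun n => ⟨h.restConfig_mem n, h.toIsEvolution.restConfig_succ n⟩⟩

/-- `restConfig` keeps only the even times; the odd ones are recovered from the evolution rule. -/
theorem IsSeparated.evolution_trajectory {W : ℤ → ℤ → SignType} (h : IsSeparated W) :
    h.trajectory.evolution = W := by
  have h0 : ∀ n x, h.trajectory n x = W (2 * n) (x - n) := fun n x => rfl
  have he : ∀ n u, h.trajectory.evolution (2 * n) u = W (2 * n) u := fun n u => by
    rw [Trajectory.evolution_even, h0, add_sub_cancel_right]
  ext k u : 2
  obtain ⟨n, rfl | rfl⟩ : ∃ n, k = 2 * n ∨ k = 2 * n + 1 := ⟨k / 2, by lia⟩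
  · exact he n u
  · refine sign_ext ?_ ?_
    · rw [h.pos_iff, h.trajectory.isEvolution.pos_iff, he, he]
    · rw [h.neg_iff, h.trajectory.isEvolution.neg_iff, he, he]

end Evolution

/-! ### Translation of paths into the moving frame. -/

section Paths

namespace PathSpace

/-- The path in the moving frame, with time counted in half units. -/
def frame (e : PathSpace) (k : ℤ) : ℤ := ⌊((e (toHalf k) : HalfInt) : ℚ) - k / 2⌋

/-- Integer places at integer times and steps `± 1/2` make place and time agree in parity, so the
floor in `frame` rounds nothing. -/
theorem apply_toHalf (e : PathSpace) (k : ℤ) : e (toHalf k) = toHalf (2 * e.frame k + k) := by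
  suffices ∃ g, e (toHalf k) = toHalf (2 * g + k) by
    obtain ⟨g, hg⟩ := this
    have : e.frame k = g := by
      rw [frame, hg, coe_toHalf, Int.floor_eq_iff]
      push_cast
      constructor <;> linarith
    rw [this, hg]
  have heven : ∀ n, ∃ g, e (toHalf (2 * n)) = toHalf (2 * g + 2 * n) := fun n => by
    obtain ⟨l, hl⟩ := toHalf_surjective (e (toHalf (2 * n)))
    obtain ⟨m, rfl⟩ := isInt_toHalf.1 (hl ▸ e.2.1 _ (isInt_toHalf.2 (even_two_mul n)))
    exact ⟨m - n, by rw [← hl]; congr 1; ring⟩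
  obtain ⟨n, rfl | rfl⟩ : ∃ n, k = 2 * n ∨ k = 2 * n + 1 := ⟨k / 2, by lia⟩
  · exact heven n
  · obtain ⟨g, hg⟩ := heven n
    have h := e.2.2 (toHalf (2 * n))
    rw [← toHalf_add_one, hg] at h
    rcases h with h | h
    · refine ⟨g, ?_⟩
      rw [← add_assoc, toHalf_add_one (2 * g + 2 * n), ← sub_eq_iff_eq_add', ← neg_sub, h, neg_neg]
    · refine ⟨g - 1, ?_⟩
      rw [show 2 * (g - 1) + (2 * n + 1) = 2 * g + 2 * n - 1 by ring,
        toHalf_sub_one (2 * g + 2 * n)]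
      have := sub_sub_cancel (toHalf (2 * g + 2 * n)) (e (toHalf (2 * n + 1)))
      rw [h] at this
      exact this.symm

theorem isPath_frame (e : PathSpace) : IsPath e.frame := fun k => by
  have h := e.2.2 (toHalf k)
  rw [← toHalf_add_one, e.apply_toHalf, e.apply_toHalf] at h
  rcases h with h | h
  · left
    rw [sub_eq_iff_eq_add', ← sub_eq_add_neg, ← toHalf_sub_one] at h
    have := toHalf_injective h
    lia
  · right
    rw [sub_eq_iff_eq_add', ← toHalf_add_one] at h
    have := toHalf_injective h
    lia

theorem frame_injective : Function.Injective frame := fun e e' h => by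
  refine Subtype.ext (funext fun i => ?_)
  obtain ⟨k, rfl⟩ := toHalf_surjective i
  have := e.apply_toHalf k
  rw [h, ← e'.apply_toHalf k] at this
  exact this

theorem exists_frame_eq {g : ℤ → ℤ} (hg : IsPath g) : ∃ e : PathSpace, e.frame = g := by
  let φ : ℤ ≃ HalfInt := Equiv.ofBijective toHalf ⟨toHalf_injective, toHalf_surjective⟩
  have hφ : ∀ k, φ.symm (toHalf k) = k := fun k => φ.symm_apply_apply k
  let e : PathSpace := ⟨fun i => toHalf (2 * g (φ.symm i) + φ.symm i), fun i hi => by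
    obtain ⟨k, rfl⟩ := toHalf_surjective i
    simp only [hφ]
    rw [isInt_toHalf, Int.even_add]
    simpa using isInt_toHalf.1 hi, fun i => by
    obtain ⟨k, rfl⟩ := toHalf_surjective i
    rw [← toHalf_add_one]
    simp only [hφ]
    rcases hg k with h | h
    · left
      rw [h, ← add_assoc, toHalf_add_one]
      abel
    · right
      rw [h, show 2 * (g k - 1) + (k + 1) = 2 * g k + k - 1 by ring, toHalf_sub_one]
      abel⟩
  have he : ∀ k, e (toHalf k) = toHalf (2 * g k + k) := fun k => by simp only [e, hφ]
  refine ⟨e, funext fun k => ?_⟩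
  have := toHalf_injective ((e.apply_toHalf k).symm.trans (he k))
  lia

end PathSpace

theorem isAnnihilation_toHalf {ω : Trajectory} {k l : ℤ} :
    IsAnnihilation ω (toHalf (k + 1)) (toHalf l) ↔
      ∃ u, l = 2 * u + (k + 1) ∧ Collide ω.evolution k u := by
  rw [IsAnnihilation, ← toHalf_sub_one, ← toHalf_sub_one, ← toHalf_add_one, add_sub_cancel_right]
  constructor
  · rintro ⟨-, h1, h2⟩
    have he : Even (k + (l - 1)) := by
      by_contra he
      rw [halfRecord_eq_zero ω he] at h1
      exact absurd h1 (by decide)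
    obtain ⟨m, hm⟩ := he
    refine ⟨m - k, by lia, ?_, ?_⟩
    · rw [← h1, Trajectory.evolution]
      congr 2
      lia
    · rw [← h2, Trajectory.evolution]
      congr 2
      lia
  · rintro ⟨u, rfl, h⟩
    refine ⟨?_, ?_, ?_⟩
    · have h1 : ω.evolution (k + 1) u = 0 :=
        sign_eq_zero (ω.isEvolution.not_pos_of_collide (by lia) h)
          fun h1 => ((ω.isEvolution.neg_iff _ _).1 h1).2 h.1
      exact h1
    · rw [← h.1, Trajectory.evolution]
      congr 2
      ring
    · rw [← h.2, Trajectory.evolution]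
      congr 2
      ring

theorem isSecondClassPath_iff {ω : Trajectory} {e : PathSpace} :
    IsSecondClassPath ω e ↔ IsSecondClass ω.evolution e.frame := by
  have hr : ∀ k, halfRecord ω (toHalf k) (e (toHalf k)) = ω.evolution k (e.frame k) := fun k => by
    rw [e.apply_toHalf, Trajectory.evolution]
  constructor
  · intro h
    refine ⟨fun k u hc => ?_, fun k hk => ?_, fun k hk => ?_⟩
    · have := h.annihilation _ _ (isAnnihilation_toHalf.2 ⟨u, rfl, hc⟩)
      rw [e.apply_toHalf] at this
      have := toHalf_injective this
      lia
    · have := h.negative (toHalf (k + 1))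
      rw [← toHalf_sub_one, add_sub_cancel_right, hr] at this
      have := this hk
      rw [e.apply_toHalf, e.apply_toHalf, ← toHalf_sub_one] at this
      have := toHalf_injective this
      lia
    · have := h.empty (toHalf (k + 1))
      rw [← toHalf_sub_one, add_sub_cancel_right, hr] at this
      have := this hk
      rw [e.apply_toHalf, e.apply_toHalf, ← toHalf_add_one] at this
      have := toHalf_injective this
      lia
  · intro h
    have hsurj : ∀ n, ∃ k, toHalf (k + 1) = n := fun n => by
      obtain ⟨k, hk⟩ := toHalf_surjective n
      exact ⟨k - 1, by rwa [sub_add_cancel]⟩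
    refine ⟨fun n m ha => ?_, fun n hn => ?_, fun n hn => ?_⟩
    · obtain ⟨k, rfl⟩ := hsurj n
      obtain ⟨l, rfl⟩ := toHalf_surjective m
      obtain ⟨u, rfl, hc⟩ := isAnnihilation_toHalf.1 ha
      rw [e.apply_toHalf, h.collide _ _ hc]
    · obtain ⟨k, rfl⟩ := hsurj n
      rw [← toHalf_sub_one, add_sub_cancel_right] at hn ⊢
      rw [hr] at hn
      rw [e.apply_toHalf, e.apply_toHalf, ← toHalf_sub_one, h.neg _ hn]
      congr 1
      ring
    · obtain ⟨k, rfl⟩ := hsurj n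
      rw [← toHalf_sub_one, add_sub_cancel_right] at hn ⊢
      rw [hr] at hn
      rw [e.apply_toHalf, e.apply_toHalf, ← toHalf_add_one, h.zero _ hn, add_assoc]

end Paths

/-! ### The pathwise correspondence. -/

section Correspondence

/-- The path makes infinitely many steps in both directions, in the past and in the future. -/
def PathSpace.Oscillates (e : PathSpace) : Prop := IsOscillating e.frame

/-- There were infinitely many annihilations in the past. -/
def Trajectory.AnnihilatesInPast (ω : Trajectory) : Prop :=
  ∀ N, ∃ k < N, ∃ u, Collide ω.evolution k u

theorem PathSpace.Oscillates.isSeparated {e : PathSpace} (h : e.Oscillates) :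
    IsSeparated (evolutionOf e.frame) := e.isPath_frame.isSeparated_evolutionOf h

theorem PathSpace.Oscillates.isSecondClassPath {e : PathSpace} (h : e.Oscillates) :
    IsSecondClassPath h.isSeparated.trajectory e := by
  rw [isSecondClassPath_iff, IsSeparated.evolution_trajectory]
  exact e.isPath_frame.isSecondClass_evolutionOf h

theorem PathSpace.Oscillates.eq_trajectory {e : PathSpace} (h : e.Oscillates) {ω : Trajectory}
    (hω : IsSecondClassPath ω e) : ω = h.isSeparated.trajectory := by
  apply Trajectory.evolution_injective
  rw [IsSeparated.evolution_trajectory]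
  exact (isSecondClassPath_iff.1 hω).eq_evolutionOf ω.isSeparated e.isPath_frame h

theorem PathSpace.Oscillates.annihilatesInPast {e : PathSpace} (h : e.Oscillates) :
    h.isSeparated.trajectory.AnnihilatesInPast := fun N => by
  obtain ⟨t, ht, htt⟩ := e.isPath_frame.exists_turn_before h N
  refine ⟨t, ht, e.frame (t + 1), ?_⟩
  rw [IsSeparated.evolution_trajectory]
  exact e.isPath_frame.collide_evolutionOf.2 ⟨htt, rfl⟩

theorem Trajectory.AnnihilatesInPast.unique {ω : Trajectory} (h : ω.AnnihilatesInPast)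
    {e e' : PathSpace} (he : IsSecondClassPath ω e) (he' : IsSecondClassPath ω e') : e = e' :=
  PathSpace.frame_injective <| (isSecondClassPath_iff.1 he).unique (isSecondClassPath_iff.1 he')
    ω.isSeparated h

theorem Trajectory.AnnihilatesInPast.exists_isSecondClassPath {ω : Trajectory}
    (h : ω.AnnihilatesInPast) : ∃ e : PathSpace, e.Oscillates ∧ IsSecondClassPath ω e := by
  obtain ⟨g, hg, ho, hs⟩ := ω.isSeparated.exists_isSecondClass h
  obtain ⟨e, rfl⟩ := PathSpace.exists_frame_eq hg
  exact ⟨e, ho, isSecondClassPath_iff.2 hs⟩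

end Correspondence

/-! ### Measurability and standard Borel structure. -/

section Measurability

theorem measurable_step : Measurable step := by
  classical
  refine measurable_pi_iff.2 fun x => ?_
  let f : SignType × SignType × SignType → SignType := fun p =>
    if p.1 = 1 ∧ ¬ (p.2.1 = -1) ∧ ¬ (p.2.1 = 0 ∧ p.2.2 = -1) then 1
    else if p.2.2 = -1 ∧ ¬ (p.2.1 = 1) ∧ ¬ (p.2.1 = 0 ∧ p.1 = 1) then -1
    else 0
  have hf : Measurable f := .of_discrete
  have : (fun ζ => step ζ x) = fun ζ : Config => f (ζ (x - 1), ζ x, ζ (x + 1)) := by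
    ext ζ
    simp only [step, f]
  rw [this]
  exact hf.comp (by fun_prop)

/-- Expresses infinitude by countable quantifiers, as needed for measurability. -/
theorem infinite_iff_forall_finset {p : ℤ → Prop} :
    {i | p i}.Infinite ↔ ∀ s : Finset ℤ, ∃ i, i ∉ s ∧ p i := by
  constructor
  · intro h s
    obtain ⟨i, hi, his⟩ := h.exists_notMem_finset s
    exact ⟨i, his, hi⟩
  · intro h hf
    obtain ⟨i, hi, hp⟩ := h hf.toFinset
    exact hi (hf.mem_toFinset.2 hp)

theorem measurableSet_phaseSepConfigs : MeasurableSet phaseSepConfigs := by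
  unfold phaseSepConfigs ExistsUnique IsConvergingPair
  simp only [infinite_iff_forall_finset]
  measurability

theorem measurableSet_trajectories :
    MeasurableSet {ω : ℤ → Config | ∀ n, ω n ∈ phaseSepConfigs ∧ ω (n + 1) = step (ω n)} := by
  simp only [Set.ofPred_forall, Set.ofPred_and]
  refine MeasurableSet.iInter fun n => .inter ?_ ?_
  · exact measurable_pi_apply n measurableSet_phaseSepConfigs
  · exact measurableSet_eq_fun (measurable_pi_apply _) (measurable_step.comp (measurable_pi_apply _))

instance : StandardBorelSpace Trajectory := measurableSet_trajectories.standardBorel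

theorem Trajectory.measurable_apply (n : ℤ) : Measurable fun ω : Trajectory => ω n :=
  (measurable_pi_apply n).comp measurable_subtype_coe

theorem measurable_trajectory_iff {α : Type*} [MeasurableSpace α] {f : α → Trajectory} :
    Measurable f ↔ ∀ n, Measurable fun a => f a n := by
  constructor
  · exact fun h n => (Trajectory.measurable_apply n).comp h
  · exact fun h => Measurable.subtype_mk (measurable_pi_iff.2 h)

theorem Trajectory.measurable_shift : Measurable Trajectory.shift :=
  measurable_trajectory_iff.2 fun n => Trajectory.measurable_apply (n - 1)

theorem PathSpace.measurable_apply (i : HalfInt) : Measurable fun e : PathSpace => e i :=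
  (measurable_pi_apply i).comp measurable_subtype_coe

theorem measurable_pathSpace_iff {α : Type*} [MeasurableSpace α] {f : α → PathSpace} :
    Measurable f ↔ ∀ i, Measurable fun a => f a i := by
  constructor
  · exact fun h n => (PathSpace.measurable_apply n).comp h
  · exact fun h => Measurable.subtype_mk (measurable_pi_iff.2 h)

theorem PathSpace.measurable_shift : Measurable PathSpace.shift :=
  measurable_pathSpace_iff.2 fun _ => PathSpace.measurable_apply _

instance : StandardBorelSpace PathSpace := by
  have : MeasurableSet {e : HalfInt → HalfInt | (∀ i, IsInt i → IsInt (e i)) ∧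
      ∀ i, e i - e (i + half) = -half ∨ e i - e (i + half) = half} := by
    have h1 : ∀ i, MeasurableSet {e : HalfInt → HalfInt | IsInt (e i)} := fun i => by
      have hm : Measurable fun e : HalfInt → HalfInt => e i := by fun_prop
      exact hm (MeasurableSet.of_discrete (s := {x : HalfInt | IsInt x}))
    have h2 : ∀ i, MeasurableSet {e : HalfInt → HalfInt |
        e i - e (i + half) = -half ∨ e i - e (i + half) = half} := fun i => by
      have hm : Measurable fun e : HalfInt → HalfInt => (e i, e (i + half)) := by fun_prop
      exact hm (MeasurableSet.of_discrete
        (s := {x : HalfInt × HalfInt | x.1 - x.2 = -half ∨ x.1 - x.2 = half}))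
    simp only [Set.ofPred_forall, Set.ofPred_and]
    exact (MeasurableSet.iInter fun i => .iInter fun _ => h1 i).inter (.iInter h2)
  exact this.standardBorel

theorem PathSpace.measurable_frame : Measurable PathSpace.frame :=
  measurable_pi_iff.2 fun k =>
    (Measurable.of_discrete (f := fun x : HalfInt => ⌊(x : ℚ) - k / 2⌋)).comp
      (PathSpace.measurable_apply _)

theorem PathSpace.measurableSet_oscillates : MeasurableSet {e : PathSpace | e.Oscillates} := by
  have : MeasurableSet {g : ℤ → ℤ | IsOscillating g} := by
    have : {g : ℤ → ℤ | IsOscillating g} = {g |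
        (∀ N, ∃ k > N, g (k + 1) = g k - 1) ∧ (∀ N, ∃ k > N, g (k + 1) = g k) ∧
        (∀ N, ∃ k < N, g (k + 1) = g k - 1) ∧ (∀ N, ∃ k < N, g (k + 1) = g k)} :=
      Set.ext fun g => ⟨fun h => ⟨h.1, h.2, h.3, h.4⟩, fun h => ⟨h.1, h.2.1, h.2.2.1, h.2.2.2⟩⟩
    rw [this]
    measurability
  exact PathSpace.measurable_frame this

theorem measurable_evolutionOf (k u : ℤ) : Measurable fun g => evolutionOf g k u := by
  unfold evolutionOf IsTurn
  refine Measurable.ite ?_ measurable_const (Measurable.ite ?_ measurable_const measurable_const)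
  · measurability
  · measurability

end Measurability

section Correspondence

/-- The paths that determine a trajectory. -/
abbrev OscillatingPath : Type := {e : PathSpace // e.Oscillates}

instance : StandardBorelSpace OscillatingPath := PathSpace.measurableSet_oscillates.standardBorel

instance : Nonempty OscillatingPath := by
  -- The staircase that alternates right and left steps.
  have hg : IsPath fun k => -(k / 2) := fun k => by lia
  obtain ⟨e, he⟩ := PathSpace.exists_frame_eq hg
  refine ⟨e, ?_⟩
  rw [PathSpace.Oscillates, he]
  exact ⟨fun N => ⟨2 * (N.natAbs : ℤ) + 1, by lia, by lia⟩, fun N => ⟨2 * ((N.natAbs : ℤ) + 1), by lia, by lia⟩,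
    fun N => ⟨-2 * (N.natAbs : ℤ) - 1, by lia, by lia⟩, fun N => ⟨-2 * ((N.natAbs : ℤ) + 1), by lia, by lia⟩⟩

/-- The trajectory that has the given path as second class path. -/
noncomputable def OscillatingPath.trajectory (e : OscillatingPath) : Trajectory :=
  e.2.isSeparated.trajectory

/-- Lusin–Souslin: a measurable injection between standard Borel spaces has measurable image and
inverse. Injectivity is the uniqueness of the second-class path. -/
theorem OscillatingPath.measurableEmbedding_trajectory :
    MeasurableEmbedding OscillatingPath.trajectory := by
  refine Measurable.measurableEmbedding ?_ fun e e' h => Subtype.ext ?_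
  · exact measurable_trajectory_iff.2 fun n => measurable_pi_iff.2 fun x =>
      (measurable_evolutionOf _ _).comp (PathSpace.measurable_frame.comp measurable_subtype_coe)
  · have h1 : IsSecondClassPath e.trajectory e := e.2.isSecondClassPath
    rw [h] at h1
    exact e'.2.annihilatesInPast.unique h1 e'.2.isSecondClassPath

theorem PathSpace.measurableEmbedding_coe :
    MeasurableEmbedding (Subtype.val : OscillatingPath → PathSpace) :=
  .subtype_coe PathSpace.measurableSet_oscillates

/-- The second class path of a trajectory. -/
noncomputable def Trajectory.secondClassPath (ω : Trajectory) : PathSpace :=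
  OscillatingPath.measurableEmbedding_trajectory.invFun ω

/-- The trajectory of a path, with a default value at paths that do not oscillate. -/
noncomputable def PathSpace.trajectory (e : PathSpace) : Trajectory :=
  
  OscillatingPath.trajectory (PathSpace.measurableEmbedding_coe.invFun e)

theorem Trajectory.measurable_secondClassPath : Measurable Trajectory.secondClassPath :=
  measurable_subtype_coe.comp OscillatingPath.measurableEmbedding_trajectory.measurable_invFun

theorem PathSpace.measurable_trajectory : Measurable PathSpace.trajectory :=
  OscillatingPath.measurableEmbedding_trajectory.measurable.comp
    PathSpace.measurableEmbedding_coe.measurable_invFun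

theorem PathSpace.Oscillates.trajectory_eq {e : PathSpace} (h : e.Oscillates) :
    e.trajectory = h.isSeparated.trajectory := by
  have := PathSpace.measurableEmbedding_coe.leftInverse_invFun ⟨e, h⟩
  rw [PathSpace.trajectory, this]
  rfl

theorem PathSpace.Oscillates.secondClassPath_trajectory {e : PathSpace} (h : e.Oscillates) :
    e.trajectory.secondClassPath = e := by
  rw [h.trajectory_eq]
  exact congrArg Subtype.val
    (OscillatingPath.measurableEmbedding_trajectory.leftInverse_invFun ⟨e, h⟩)

namespace Trajectory.AnnihilatesInPast

variable {ω : Trajectory}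

theorem eq_secondClassPath (h : ω.AnnihilatesInPast) {e : PathSpace} (he : IsSecondClassPath ω e) :
    e = ω.secondClassPath := by
  obtain ⟨e', ho, he'⟩ := h.exists_isSecondClassPath
  obtain rfl := h.unique he he'
  rw [ho.eq_trajectory he', ← ho.trajectory_eq, ho.secondClassPath_trajectory]

theorem oscillates (h : ω.AnnihilatesInPast) : ω.secondClassPath.Oscillates := by
  obtain ⟨e', ho, he'⟩ := h.exists_isSecondClassPath
  exact h.eq_secondClassPath he' ▸ ho

theorem isSecondClassPath (h : ω.AnnihilatesInPast) :
    IsSecondClassPath ω ω.secondClassPath := by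
  obtain ⟨e', ho, he'⟩ := h.exists_isSecondClassPath
  exact h.eq_secondClassPath he' ▸ he'

theorem eq_of_isSecondClassPath (h : ω.AnnihilatesInPast) {ω' : Trajectory}
    (h' : IsSecondClassPath ω' ω.secondClassPath) : ω' = ω := by
  rw [h.oscillates.eq_trajectory h', ← h.oscillates.eq_trajectory h.isSecondClassPath]

theorem trajectory_secondClassPath (h : ω.AnnihilatesInPast) :
    ω.secondClassPath.trajectory = ω := by
  rw [h.oscillates.trajectory_eq, ← h.oscillates.eq_trajectory h.isSecondClassPath]

end Trajectory.AnnihilatesInPast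

end Correspondence

/-! ### Equivariance under the time shifts. -/

section Shift

theorem toHalf_add_two (k : ℤ) : toHalf (k + 2) = toHalf k + (half + half) := by
  rw [← add_assoc, ← toHalf_add_one, ← toHalf_add_one, add_assoc]
  rfl

/-- A unit of time is two half units, during which the frame advances by one place. -/
theorem PathSpace.frame_shift (e : PathSpace) (k : ℤ) :
    e.shift.frame k = e.frame (k + 2) + 1 := by
  have h1 : e.shift (toHalf k) = e (toHalf (k + 2)) := by
    rw [toHalf_add_two]
    rfl
  rw [PathSpace.apply_toHalf, PathSpace.apply_toHalf] at h1
  have := toHalf_injective h1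
  lia

theorem Trajectory.evolution_shift (ω : Trajectory) (k u : ℤ) :
    ω.shift.evolution (k + 2) u = ω.evolution k (u + 1) := by
  have h0 : ∀ n x, ω.shift n x = ω (n - 1) x := fun n x => rfl
  have he : ∀ n u, ω.shift.evolution (2 * (n + 1)) u = ω.evolution (2 * n) (u + 1) := fun n u => by
    rw [evolution_even, evolution_even, h0, add_sub_cancel_right,
      add_right_comm, add_assoc]
  obtain ⟨n, rfl | rfl⟩ : ∃ n, k = 2 * n ∨ k = 2 * n + 1 := ⟨k / 2, by lia⟩
  · rw [show 2 * n + 2 = 2 * (n + 1) by ring, he]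
  · rw [show 2 * n + 1 + 2 = 2 * (n + 1) + 1 by ring]
    refine sign_ext ?_ ?_
    · rw [ω.isEvolution.pos_iff, ω.shift.isEvolution.pos_iff, he, he]
    · rw [ω.isEvolution.neg_iff, ω.shift.isEvolution.neg_iff, he, he]

/-- The shifts of trajectories and of paths run in opposite directions, hence one on each side. -/
theorem isSecondClassPath_shift {ω : Trajectory} {e : PathSpace} :
    IsSecondClassPath ω.shift e ↔ IsSecondClassPath ω e.shift := by
  have hW : ∀ k u, ω.shift.evolution k u = ω.evolution (k - 2) (u + 1) := fun k u => by
    rw [← Trajectory.evolution_shift, sub_add_cancel]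
  rw [isSecondClassPath_iff, isSecondClassPath_iff]
  constructor
  · intro h
    refine ⟨fun k u hc => ?_, fun k hk => ?_, fun k hk => ?_⟩
    · have := h.collide (k + 2) (u - 1) (by
        rw [Collide, hW, hW, add_sub_cancel_right, sub_add_cancel]
        exact hc)
      rw [e.frame_shift, show k + 1 + 2 = k + 2 + 1 by ring]
      lia
    · rw [e.frame_shift] at hk ⊢
      have := h.neg (k + 2) (by rw [hW, add_sub_cancel_right]; exact hk)
      rw [e.frame_shift, show k + 1 + 2 = k + 2 + 1 by ring]
      lia
    · rw [e.frame_shift] at hk ⊢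
      have := h.zero (k + 2) (by rw [hW, add_sub_cancel_right]; exact hk)
      rw [e.frame_shift, show k + 1 + 2 = k + 2 + 1 by ring]
      lia
  · intro h
    have hf : ∀ k, e.frame k = e.shift.frame (k - 2) - 1 := fun k => by
      rw [e.frame_shift, sub_add_cancel, add_sub_cancel_right]
    refine ⟨fun k u hc => ?_, fun k hk => ?_, fun k hk => ?_⟩
    · rw [Collide, hW, hW] at hc
      have := h.collide (k - 2) (u + 1) hc
      rw [hf, show k + 1 - 2 = k - 2 + 1 by ring]
      lia
    · rw [hW, hf, sub_add_cancel] at hk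
      have := h.neg (k - 2) hk
      rw [hf, hf, show k + 1 - 2 = k - 2 + 1 by ring]
      lia
    · rw [hW, hf, sub_add_cancel] at hk
      have := h.zero (k - 2) hk
      rw [hf, hf, show k + 1 - 2 = k - 2 + 1 by ring]
      lia

theorem Trajectory.AnnihilatesInPast.shift_secondClassPath {ω : Trajectory}
    (h : ω.AnnihilatesInPast) (h' : ω.shift.AnnihilatesInPast) :
    ω.shift.secondClassPath.shift = ω.secondClassPath :=
  h.eq_secondClassPath (isSecondClassPath_shift.1 h'.isSecondClassPath)

theorem PathSpace.Oscillates.shift_trajectory {e : PathSpace} (h : e.Oscillates)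
    (h' : e.shift.Oscillates) : e.shift.trajectory.shift = e.trajectory := by
  rw [h.trajectory_eq, h'.trajectory_eq]
  exact h.eq_trajectory (isSecondClassPath_shift.2 h'.isSecondClassPath)

theorem Trajectory.shift_iterate (ω : Trajectory) (n : ℕ) (m : ℤ) :
    (Trajectory.shift^[n] ω) m = ω (m - n) := by
  induction n generalizing m with
  | zero => simp
  | succ n ih =>
    rw [Function.iterate_succ_apply']
    have : (Trajectory.shift^[n] ω).shift m = (Trajectory.shift^[n] ω) (m - 1) := rfl
    rw [this, ih, show m - 1 - (n : ℤ) = m - (n + 1 : ℕ) by push_cast; ring]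

/-- The inverse of the shift of time on paths. -/
def PathSpace.unshift (e : PathSpace) : PathSpace :=
  ⟨fun i => e (i - (half + half)), fun i hi => e.2.1 _ (by
      obtain ⟨k, hk⟩ := hi
      refine ⟨k - 1, ?_⟩
      simp only [AddSubgroup.coe_sub, AddSubgroup.coe_add, half, hk]
      push_cast
      ring), fun i => by
    have h := e.2.2 (i - (half + half))
    rwa [show i - (half + half) + half = i + half - (half + half) by abel] at h⟩

theorem PathSpace.measurable_unshift : Measurable PathSpace.unshift :=
  measurable_pathSpace_iff.2 fun _ => PathSpace.measurable_apply _

theorem PathSpace.unshift_shift (e : PathSpace) : e.shift.unshift = e :=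
  Subtype.ext (funext fun i => congrArg e.1 (sub_add_cancel i _))

theorem PathSpace.shift_unshift (e : PathSpace) : e.unshift.shift = e :=
  Subtype.ext (funext fun i => congrArg e.1 (add_sub_cancel_right i _))

theorem PathSpace.frame_unshift (e : PathSpace) (k : ℤ) :
    e.unshift.frame k = e.frame (k - 2) - 1 := by
  have := e.unshift.frame_shift (k - 2)
  rw [e.shift_unshift, sub_add_cancel] at this
  lia

end Shift

/-! ### Poincaré recurrence. -/

section Recurrence

/-- In the frame at rest this says that the path returns to its place at time `0` infinitely often;
`a = 1` and `a = -1` treat the future and the past. -/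
theorem ae_frequently_frame {Q : Measure PathSpace} [IsFiniteMeasure Q] {T : PathSpace → PathSpace}
    (hT : MeasurePreserving T Q Q) {a : ℤ} (hTf : ∀ e k, (T e).frame k = e.frame (k + 2 * a) + a) :
    ∀ᵐ e ∂Q, ∀ M : ℕ, ∃ n ≥ M, e.frame (2 * a * n) + a * n = e.frame 0 := by
  have hit : ∀ (n : ℕ) (e : PathSpace) (k : ℤ),
      (T^[n] e).frame k = e.frame (k + 2 * a * n) + a * n := by
    intro n
    induction n with
    | zero => simp
    | succ n ih =>
      intro e k
      rw [Function.iterate_succ_apply', hTf, ih]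
      push_cast
      ring_nf
  have h : ∀ m : ℤ, ∀ᵐ e ∂Q, e.frame 0 = m → ∃ᶠ n in Filter.atTop, (T^[n] e).frame 0 = m :=
    fun m => by
      have hs : MeasurableSet {e : PathSpace | e.frame 0 = m} :=
        ((measurable_pi_apply 0).comp PathSpace.measurable_frame) (measurableSet_singleton m)
      exact hT.conservative.ae_mem_imp_frequently_image_mem hs.nullMeasurableSet
  filter_upwards [ae_all_iff.2 h] with e he M
  obtain ⟨n, hn, hn'⟩ := Filter.frequently_atTop.1 (he _ rfl) M
  rw [hit, zero_add] at hn'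
  exact ⟨n, hn, hn'⟩

/-- A path that makes only steps of one kind beyond some time cannot return to its starting place
infinitely often. -/
theorem ae_oscillates {Q : Measure PathSpace} [IsFiniteMeasure Q]
    (hQ : MeasurePreserving PathSpace.shift Q Q) : ∀ᵐ e ∂Q, e.Oscillates := by
  have hQ' : MeasurePreserving PathSpace.unshift Q Q := by
    refine ⟨PathSpace.measurable_unshift, ?_⟩
    conv_lhs => rw [← hQ.map_eq]
    rw [Measure.map_map PathSpace.measurable_unshift PathSpace.measurable_shift]
    have : PathSpace.unshift ∘ PathSpace.shift = id := funext PathSpace.unshift_shift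
    rw [this, Measure.map_id]
  filter_upwards [ae_frequently_frame hQ (a := 1) fun e k => e.frame_shift k,
    ae_frequently_frame hQ' (a := -1) fun e k => by rw [e.frame_unshift]; rfl] with e h1 h2
  have hp := e.isPath_frame
  have hright : ∀ s t, s ≤ t → (∀ k, s ≤ k → k < t → e.frame (k + 1) = e.frame k) →
      e.frame t = e.frame s := by
    intro s t hst
    induction t, hst using Int.leInduction with
    | base => exact fun _ => rfl
    | succ t hst ih =>
      intro h
      rw [h t hst (by lia), ih fun k hk hk' => h k hk (by lia)]
  have hleft : ∀ s t, s ≤ t → (∀ k, s ≤ k → k < t → e.frame (k + 1) = e.frame k - 1) →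
      e.frame t + t = e.frame s + s := by
    intro s t hst
    induction t, hst using Int.leInduction with
    | base => exact fun _ => rfl
    | succ t hst ih =>
      intro h
      rw [h t hst (by lia), ← ih fun k hk hk' => h k hk (by lia)]
      ring
  refine ⟨fun N => ?_, fun N => ?_, fun N => ?_, fun N => ?_⟩ <;> by_contra! hN
  · obtain ⟨n, hn, hn'⟩ := h1 ((N.natAbs : ℤ) + 1).toNat
    obtain ⟨m, hm, hm'⟩ := h1 (n + 1)
    have := hright (2 * 1 * n) (2 * 1 * m) (by lia)
      fun k hk _ => (hp k).resolve_right (hN k (by lia))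
    lia
  · obtain ⟨n, hn, hn'⟩ := h1 ((N.natAbs : ℤ) + 1).toNat
    obtain ⟨m, hm, hm'⟩ := h1 (n + 1)
    have := hleft (2 * 1 * n) (2 * 1 * m) (by lia)
      fun k hk _ => (hp k).resolve_left (hN k (by lia))
    lia
  · obtain ⟨n, hn, hn'⟩ := h2 ((N.natAbs : ℤ) + 1).toNat
    obtain ⟨m, hm, hm'⟩ := h2 (n + 1)
    have := hright (2 * -1 * m) (2 * -1 * n) (by lia)
      fun k _ hk => (hp k).resolve_right (hN k (by lia))
    lia
  · obtain ⟨n, hn, hn'⟩ := h2 ((N.natAbs : ℤ) + 1).toNat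
    obtain ⟨m, hm, hm'⟩ := h2 (n + 1)
    have := hleft (2 * -1 * m) (2 * -1 * n) (by lia)
      fun k _ hk => (hp k).resolve_left (hN k (by lia))
    lia

/-- By recurrence an occupied place `i` held positive particles at times `-n` with `n` arbitrarily
large. Without annihilations before `N`, these would all survive until `N`, at moving sites `i + n`
that exceed the site of a negative particle. -/
theorem ae_annihilatesInPast {P : Measure Trajectory} [IsFiniteMeasure P]
    (hP : MeasurePreserving Trajectory.shift P P) : ∀ᵐ ω ∂P, ω.AnnihilatesInPast := by
  have h : ∀ i : ℤ, ∀ᵐ ω ∂P, ω 0 i = 1 →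
      ∃ᶠ n in Filter.atTop, (Trajectory.shift^[n] ω) 0 i = 1 :=
    fun i => by
      have hs : MeasurableSet {ω : Trajectory | ω 0 i = 1} :=
        ((measurable_pi_apply i).comp (Trajectory.measurable_apply 0)) (measurableSet_singleton 1)
      exact hP.conservative.ae_mem_imp_frequently_image_mem hs.nullMeasurableSet
  filter_upwards [ae_all_iff.2 h] with ω hω N
  by_contra! hN
  obtain ⟨i, -, hi⟩ := ω.isSeparated.exists_pos (2 * 0) 0
  rw [ω.evolution_even, add_zero] at hi
  obtain ⟨v, -, hv⟩ := ω.isSeparated.exists_neg N 0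
  obtain ⟨n, hn, hn'⟩ := Filter.frequently_atTop.1 (hω i hi) ((N.natAbs : ℤ) + (v - i).natAbs + 1).toNat
  rw [Trajectory.shift_iterate, zero_sub] at hn'
  have h1 : ω.evolution (2 * -(n : ℤ)) (i + n) = 1 := by
    rw [ω.evolution_even, add_neg_cancel_right, hn']
  have h2 := ω.isSeparated.pos_of_not_collide (t := N) (by lia) h1 fun s _ hs => hN s hs _
  have := ω.isSeparated.lt _ _ _ h2 hv
  lia

end Recurrence

/-! ### Existence and uniqueness of the two-sided process. -/

open ProbabilityTheory in
/-- A measure preserving transformation of a standard Borel space has a natural extension. -/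
theorem exists_backward_orbit_measure {X : Type*} [MeasurableSpace X] [StandardBorelSpace X]
    [Nonempty X] {μ : Measure X} [IsProbabilityMeasure μ] {T : X → X}
    (hT : MeasurePreserving T μ μ) :
    ∃ ν : Measure (ℕ → X), IsProbabilityMeasure ν ∧ (∀ n, ν.map (fun x => x n) = μ) ∧
      ∀ᵐ x ∂ν, ∀ n, T (x (n + 1)) = x n := by
  have hg : Measurable fun x => (T x, x) := hT.measurable.prodMk measurable_id
  let ρ : Measure (X × X) := μ.map fun x => (T x, x)
  have : IsProbabilityMeasure ρ := Measure.isProbabilityMeasure_map hg.aemeasurable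
  have hfst : ρ.fst = μ := by
    exact (Measure.fst_map_prodMk measurable_id).trans hT.map_eq
  have hsnd : ρ.snd = μ := by
    exact (Measure.snd_map_prodMk hT.measurable).trans Measure.map_id
  have hρ : μ.compProd ρ.condKernel = ρ := by
    conv_rhs => rw [← ρ.disintegrate ρ.condKernel, hfst]
  -- The backward Markov chain: each new point is drawn from the conditional law of a point given
  -- its image under `T`, so consecutive points have the joint law `ρ` of `(T x, x)`.
  let κ : (n : ℕ) → Kernel (Finset.Iic n → X) X := fun n =>
    ρ.condKernel.comap (fun x => x ⟨n, Finset.mem_Iic.2 le_rfl⟩) (measurable_pi_apply _)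
  let ν : Measure (ℕ → X) := Kernel.trajMeasure (X := fun _ => X) μ κ
  have hpair : ∀ n, ν.map (fun x => x n) = μ → ν.map (fun x => (x n, x (n + 1))) = ρ := fun n hn => by
    have h := Kernel.map_frestrictLe_trajMeasure_compProd_eq_map_trajMeasure
      (X := fun _ => X) (μ₀ := μ) (κ := κ) (a := n)
    have hev : Measurable fun y : Finset.Iic n → X => y ⟨n, Finset.mem_Iic.2 le_rfl⟩ :=
      measurable_pi_apply _
    have hfr : (ν.map (Preorder.frestrictLe n)).map
        (fun y : Finset.Iic n → X => y ⟨n, Finset.mem_Iic.2 le_rfl⟩) = μ := by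
      rw [Measure.map_map hev (Preorder.measurable_frestrictLe n)]
      exact hn
    have h2 : ν.map (fun x => (x n, x (n + 1))) =
        ((ν.map (Preorder.frestrictLe n)).compProd (κ n)).map
          (Prod.map (fun y : Finset.Iic n → X => y ⟨n, Finset.mem_Iic.2 le_rfl⟩) id) := by
      rw [h, Measure.map_map (hev.prodMap measurable_id) (by fun_prop)]
      rfl
    rw [h2, ← hρ]
    ext s hs
    rw [Measure.map_apply (hev.prodMap measurable_id) hs,
      Measure.compProd_apply (hev.prodMap measurable_id hs), Measure.compProd_apply hs]
    have h3 := lintegral_map (μ := ν.map (Preorder.frestrictLe n))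
      (Kernel.measurable_kernel_prodMk_left (κ := ρ.condKernel) hs) hev
    rw [hfr] at h3
    exact h3.symm
  have hmarg : ∀ n, ν.map (fun x => x n) = μ := fun n => by
    induction n with
    | zero =>
      have hev : Measurable fun y : Finset.Iic 0 → X => y ⟨0, Finset.mem_Iic.2 le_rfl⟩ :=
        measurable_pi_apply _
      have h : ν.map (Preorder.frestrictLe 0) =
          μ.map (MeasurableEquiv.piUnique (fun _ : Finset.Iic 0 => X)).symm := by
        change Measure.map _ (Measure.bind _ _) = _
        rw [Measure.map_comp _ _ (Preorder.measurable_frestrictLe 0), Kernel.traj_map_frestrictLe,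
          Kernel.partialTraj_self, Measure.id_comp]
      have h2 := congrArg (Measure.map fun y : Finset.Iic 0 → X => y ⟨0, Finset.mem_Iic.2 le_rfl⟩) h
      rw [Measure.map_map hev (Preorder.measurable_frestrictLe 0),
        Measure.map_map hev (MeasurableEquiv.measurable _)] at h2
      exact h2.trans Measure.map_id
    | succ n ih =>
      have := congrArg Measure.snd (hpair n ih)
      rwa [Measure.snd_map_prodMk (measurable_pi_apply _), hsnd] at this
  refine ⟨ν, inferInstance, hmarg, ae_all_iff.2 fun n => ?_⟩
  have hm : MeasurableSet {p : X × X | T p.2 = p.1} :=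
    measurableSet_eq_fun (hT.measurable.comp measurable_snd) measurable_fst
  have h1 : ∀ᵐ p ∂ρ, T p.2 = p.1 := (ae_map_iff hg.aemeasurable hm).2 (by simp)
  rw [← hpair n (hmarg n)] at h1
  exact ae_of_ae_map (by fun_prop) h1

theorem Trajectory.apply_add (ω : Trajectory) (N : ℤ) (n : ℕ) : ω (N + n) = step^[n] (ω N) := by
  induction n with
  | zero => simp
  | succ n ih =>
    rw [Function.iterate_succ_apply', ← ih, ← (ω.2 _).2, Nat.cast_succ, add_assoc]

/-- Events at a single time already form a generating π-system: in an intersection, the later event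
is pulled back to the earlier time by iterates of `step`. -/
theorem Trajectory.measure_ext {P P' : Measure Trajectory} [IsProbabilityMeasure P]
    [IsProbabilityMeasure P']
    (h : ∀ n, P.map (fun ω => ω n) = P'.map (fun ω => ω n)) : P = P' := by
  let C : Set (Set Trajectory) := {s | ∃ n, ∃ B, MeasurableSet B ∧ s = (fun ω : Trajectory => ω n) ⁻¹' B}
  refine ext_of_generate_finite C (le_antisymm ?_ ?_) ?_ ?_ (by simp)
  · have : @Measurable _ _ (MeasurableSpace.generateFrom C) _ (fun ω : Trajectory => ω.1) :=
      @measurable_pi_iff _ _ _ (MeasurableSpace.generateFrom C) _ _ |>.2 fun n B hB =>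
        MeasurableSpace.measurableSet_generateFrom ⟨n, B, hB, rfl⟩
    exact this.comap_le
  · refine MeasurableSpace.generateFrom_le ?_
    rintro _ ⟨n, B, hB, rfl⟩
    exact Trajectory.measurable_apply n hB
  · have key : ∀ n (m : ℕ) B B', MeasurableSet B → MeasurableSet B' →
        (fun ω : Trajectory => ω n) ⁻¹' B ∩ (fun ω : Trajectory => ω (n + m)) ⁻¹' B' ∈ C := by
      intro n m B B' hB hB'
      refine ⟨n, B ∩ step^[m] ⁻¹' B', hB.inter (measurable_step.iterate m hB'), ?_⟩
      ext ω
      simp only [Set.mem_inter_iff, Set.mem_preimage, Trajectory.apply_add]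
    rintro _ ⟨n, B, hB, rfl⟩ _ ⟨n', B', hB', rfl⟩ -
    rcases le_total n n' with hnn | hnn
    · obtain ⟨m, rfl⟩ := Int.le.dest hnn
      exact key _ _ _ _ hB hB'
    · obtain ⟨m, rfl⟩ := Int.le.dest hnn
      rw [Set.inter_comm]
      exact key _ _ _ _ hB' hB
  · rintro _ ⟨n, B, hB, rfl⟩
    rw [← Measure.map_apply (Trajectory.measurable_apply n) hB, h,
      Measure.map_apply (Trajectory.measurable_apply n) hB]

theorem isTwoSidedBA_of_marginal {μ : ProbabilityMeasure Config} {P : ProbabilityMeasure Trajectory}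
    (h : ∀ n : ℤ, (P : Measure Trajectory).map (fun ω => ω n) = (μ : Measure Config)) :
    IsTwoSidedBA μ P := by
  refine ⟨h, Trajectory.measurable_shift, ?_⟩
  have := Measure.isProbabilityMeasure_map (μ := (P : Measure Trajectory))
    Trajectory.measurable_shift.aemeasurable
  refine Trajectory.measure_ext fun n => ?_
  rw [Measure.map_map (Trajectory.measurable_apply n) Trajectory.measurable_shift, h]
  exact h (n - 1)

theorem exists_isTwoSidedBA {μ : ProbabilityMeasure Config}
    (hμ : μ ∈ phaseSepMeasures ∩ invariantMeasures) : ∃ P, IsTwoSidedBA μ P := by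
  obtain ⟨hS, hI⟩ := hμ
  change ∀ᵐ ζ ∂(μ : Measure Config), ζ ∈ phaseSepConfigs at hS
  obtain ⟨ν, _, hν, hstep⟩ := exists_backward_orbit_measure hI
  -- Negative times read the backward orbit and positive times iterate `step` from its start;
  -- `toNat` makes the other half trivial.
  let R : (ℕ → Config) → ℤ → Config := fun x n => step^[n.toNat] (x (-n).toNat)
  have hRn : ∀ n, Measurable fun x => R x n := fun n =>
    (measurable_step.iterate _).comp (measurable_pi_apply _)
  have hR : Measurable R := measurable_pi_iff.2 hRn
  have hmarg : ∀ n, ν.map (fun x => R x n) = (μ : Measure Config) := fun n => by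
    rw [← (hI.iterate n.toNat).map_eq, ← hν (-n).toNat,
      Measure.map_map (measurable_step.iterate _) (measurable_pi_apply _)]
    rfl
  have hae : ∀ᵐ x ∂ν, ∀ n, R x n ∈ phaseSepConfigs ∧ R x (n + 1) = step (R x n) := by
    have hmem : ∀ n, ∀ᵐ x ∂ν, R x n ∈ phaseSepConfigs := fun n => by
      rw [← hmarg n] at hS
      exact ae_of_ae_map (hRn n).aemeasurable hS
    filter_upwards [hstep, ae_all_iff.2 hmem] with x hx hx' n
    refine ⟨hx' n, ?_⟩
    simp only [R]
    rcases le_or_gt 0 n with hn | hn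
    · rw [show (n + 1).toNat = n.toNat + 1 by lia, show (-(n + 1)).toNat = 0 by lia,
        show (-n).toNat = 0 by lia, Function.iterate_succ_apply']
    · rw [show (n + 1).toNat = 0 by lia, show n.toNat = 0 by lia,
        show (-n).toNat = (-(n + 1)).toNat + 1 by lia]
      exact (hx _).symm
  have hemb : MeasurableEmbedding (Subtype.val : Trajectory → ℤ → Config) :=
    .subtype_coe measurableSet_trajectories
  have hPmap : ((ν.map R).comap (Subtype.val : Trajectory → ℤ → Config)).map Subtype.val = ν.map R := by
    rw [hemb.map_comap, Measure.restrict_eq_self_of_ae_mem]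
    refine (ae_map_iff (p := (· ∈ Set.range Subtype.val)) hR.aemeasurable
      hemb.measurableSet_range).2 ?_
    filter_upwards [hae] with x hx
    exact ⟨⟨R x, hx⟩, rfl⟩
  have hprob : IsProbabilityMeasure ((ν.map R).comap (Subtype.val : Trajectory → ℤ → Config)) := by
    have : IsProbabilityMeasure (ν.map R) := Measure.isProbabilityMeasure_map hR.aemeasurable
    refine ⟨?_⟩
    rw [← measure_univ (μ := ν.map R)]
    conv_rhs => rw [← hPmap, Measure.map_apply hemb.measurable .univ, Set.preimage_univ]
  refine ⟨⟨_, hprob⟩, isTwoSidedBA_of_marginal fun n => ?_⟩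
  have h1 : (fun ω : Trajectory => ω n) = (fun ω : ℤ → Config => ω n) ∘ Subtype.val := rfl
  change Measure.map _ ((ν.map R).comap Subtype.val) = _
  rw [h1, ← Measure.map_map (measurable_pi_apply n) hemb.measurable, hPmap,
    Measure.map_map (measurable_pi_apply n) hR]
  exact hmarg n

theorem IsTwoSidedBA.unique {μ : ProbabilityMeasure Config} {P P' : ProbabilityMeasure Trajectory}
    (h : IsTwoSidedBA μ P) (h' : IsTwoSidedBA μ P') : P = P' :=
  ProbabilityMeasure.toMeasure_injective (Trajectory.measure_ext fun n => (h.marginal n).trans (h'.marginal n).symm)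

/-! ### Transport of laws between trajectories and paths. -/

theorem IsTwoSidedBA.secondClassPath_mem {μ : ProbabilityMeasure Config}
    {P : ProbabilityMeasure Trajectory} (h : IsTwoSidedBA μ P) :
    P.map (f := Trajectory.secondClassPath) Trajectory.measurable_secondClassPath.aemeasurable ∈
      invariantPathMeasures := by
  refine ⟨PathSpace.measurable_shift, ?_⟩
  have hF := Trajectory.measurable_secondClassPath
  have hae := ae_annihilatesInPast h.stationary
  rw [ProbabilityMeasure.toMeasure_map]
  conv_lhs => rw [← h.stationary.map_eq]
  rw [Measure.map_map hF Trajectory.measurable_shift, Measure.map_map PathSpace.measurable_shift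
    (hF.comp Trajectory.measurable_shift)]
  refine Measure.map_congr ?_
  filter_upwards [hae, h.stationary.quasiMeasurePreserving.ae hae] with ω h1 h2
  exact h1.shift_secondClassPath h2

theorem exists_isTwoSidedBA_of_path {Q : ProbabilityMeasure PathSpace}
    (hQ : Q ∈ invariantPathMeasures) : ∃ μ ∈ phaseSepMeasures ∩ invariantMeasures, ∃ P,
      IsTwoSidedBA μ P ∧ (P : Measure Trajectory).map Trajectory.secondClassPath = Q := by
  have hQ : MeasurePreserving PathSpace.shift (Q : Measure PathSpace) (Q : Measure PathSpace) := hQ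
  have hae := ae_oscillates hQ
  have hΦ := PathSpace.measurable_trajectory
  let P : ProbabilityMeasure Trajectory := Q.map hΦ.aemeasurable
  have hP : (P : Measure Trajectory) = (Q : Measure PathSpace).map PathSpace.trajectory := rfl
  have hst : (P : Measure Trajectory).map Trajectory.shift = P := by
    rw [hP]
    conv_lhs => rw [← hQ.map_eq]
    rw [Measure.map_map hΦ PathSpace.measurable_shift, Measure.map_map Trajectory.measurable_shift
      (hΦ.comp PathSpace.measurable_shift)]
    refine Measure.map_congr ?_
    filter_upwards [hae, hQ.quasiMeasurePreserving.ae hae] with e h1 h2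
    exact h1.shift_trajectory h2
  have hsucc : ∀ n : ℤ, (P : Measure Trajectory).map (fun ω => ω (n + 1)) =
      (P : Measure Trajectory).map (fun ω => ω n) := fun n => by
    conv_lhs => rw [← hst]
    rw [Measure.map_map (Trajectory.measurable_apply _) Trajectory.measurable_shift]
    congr 1
    ext ω : 1
    exact congrArg ω.1 (add_sub_cancel_right n 1)
  let μ : ProbabilityMeasure Config := P.map (Trajectory.measurable_apply 0).aemeasurable
  have hμ : (μ : Measure Config) = (P : Measure Trajectory).map (fun ω => ω 0) := rfl
  have hmarg : ∀ n : ℤ, (P : Measure Trajectory).map (fun ω => ω n) = (μ : Measure Config) := by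
    intro n
    induction n using Int.induction_on with
    | zero => rfl
    | succ n ih => rw [hsucc, ih]
    | pred n ih => rw [← ih, ← hsucc, sub_add_cancel]
  refine ⟨μ, ⟨?_, ?_⟩, P, isTwoSidedBA_of_marginal hmarg, ?_⟩
  · change ∀ᵐ ζ ∂(μ : Measure Config), ζ ∈ phaseSepConfigs
    rw [hμ]
    exact (ae_map_iff (p := (· ∈ phaseSepConfigs)) (Trajectory.measurable_apply 0).aemeasurable
      measurableSet_phaseSepConfigs).2 (ae_of_all _ fun ω => (ω.2 0).1)
  · refine ⟨measurable_step, ?_⟩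
    rw [hμ, Measure.map_map measurable_step (Trajectory.measurable_apply 0), ← hsucc]
    congr 1
    ext ω : 1
    exact (ω.2 0).2.symm
  · rw [hP, Measure.map_map Trajectory.measurable_secondClassPath hΦ]
    conv_rhs => rw [← Measure.map_id (μ := (Q : Measure PathSpace))]
    refine Measure.map_congr ?_
    filter_upwards [hae] with e he
    exact he.secondClassPath_trajectory

theorem IsTwoSidedBA.map_trajectory {μ : ProbabilityMeasure Config}
    {P : ProbabilityMeasure Trajectory} (h : IsTwoSidedBA μ P) :
    ((P : Measure Trajectory).map Trajectory.secondClassPath).map PathSpace.trajectory = P := by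
  rw [Measure.map_map PathSpace.measurable_trajectory Trajectory.measurable_secondClassPath]
  conv_rhs => rw [← Measure.map_id (μ := (P : Measure Trajectory))]
  refine Measure.map_congr ?_
  filter_upwards [ae_annihilatesInPast h.stationary] with ω hω
  exact hω.trajectory_secondClassPath

end BallisticAnnihilation

open BallisticAnnihilation

theorem theorem2p3 :
    -- each `μ ∈ S ∩ I` is the marginal law of a unique two-sided stationary BA
    (∀ μ ∈ phaseSepMeasures ∩ invariantMeasures, ∃! P, IsTwoSidedBA μ P) ∧
    -- there is a map `F` from trajectories to paths which
    ∃ F : Trajectory → PathSpace, Measurable F ∧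
      -- almost surely sends `ω` to its unique second class path, and this path determines `ω`
      (∀ μ ∈ phaseSepMeasures ∩ invariantMeasures, ∀ P, IsTwoSidedBA μ P →
        ∀ᵐ ω ∂(P : Measure Trajectory),
          IsSecondClassPath ω (F ω) ∧
          (∀ e, IsSecondClassPath ω e → e = F ω) ∧
          (∀ ω₁, IsSecondClassPath ω₁ (F ω) → ω₁ = ω)) ∧
      -- and the law of the second class path defines a bijection `S ∩ I → E_τ`
      ∃ Fstar : ↥(phaseSepMeasures ∩ invariantMeasures) → ↥invariantPathMeasures,
        Function.Bijective Fstar ∧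
        ∀ μ P, IsTwoSidedBA μ.1 P →
          ((Fstar μ).1 : Measure PathSpace) = (P : Measure Trajectory).map F := by
  refine ⟨fun μ hμ => ?_, Trajectory.secondClassPath, Trajectory.measurable_secondClassPath,
    fun μ _ P hP => ?_, ?_⟩
  · obtain ⟨P, hP⟩ := exists_isTwoSidedBA hμ
    exact ⟨P, hP, fun P' hP' => hP'.unique hP⟩
  · filter_upwards [ae_annihilatesInPast hP.stationary] with ω hω
    exact ⟨hω.isSecondClassPath, fun e => hω.eq_secondClassPath,
      fun ω₁ => hω.eq_of_isSecondClassPath⟩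
  -- The choice is immaterial, since the two-sided law is unique.
  · choose Pr hPr using fun μ : ↥(phaseSepMeasures ∩ invariantMeasures) => exists_isTwoSidedBA μ.2
    refine ⟨fun μ => ⟨_, (hPr μ).secondClassPath_mem⟩, ⟨fun μ ν h => ?_, fun Q => ?_⟩,
      fun μ P hP => ?_⟩
    · have h1 : (Pr μ : Measure Trajectory).map Trajectory.secondClassPath =
          (Pr ν : Measure Trajectory).map Trajectory.secondClassPath :=
        congrArg (fun Q => (Q.1 : Measure PathSpace)) h
      have h2 : (Pr μ : Measure Trajectory) = Pr ν := by
        rw [← (hPr μ).map_trajectory, h1, (hPr ν).map_trajectory]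
      refine Subtype.ext (Subtype.ext ?_)
      change (μ.1 : Measure Config) = (ν.1 : Measure Config)
      rw [← (hPr μ).marginal 0, h2, (hPr ν).marginal 0]
    · obtain ⟨μ, hμ, P, hP, hPQ⟩ := exists_isTwoSidedBA_of_path Q.2
      refine ⟨⟨μ, hμ⟩, Subtype.ext (Subtype.ext ?_)⟩
      change (Pr ⟨μ, hμ⟩ : Measure Trajectory).map Trajectory.secondClassPath = (Q.1 : Measure PathSpace)
      rw [← hPQ, (hPr ⟨μ, hμ⟩).unique hP]
    · change (Pr μ : Measure Trajectory).map Trajectory.secondClassPath = _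
      rw [(hPr μ).unique hP]
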